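/- For a finite simplicial graph $\Gamma$ let $A(\Gamma)=\langle v\in V(\Gamma)\mid [u,v]=1 \text{ for } \{u,v\}\in E(\Gamma)\rangle$ be its right-angled Artin group, and write $x^g=g^{-1}xg$. The extension graph $\Gamma^e$ has as vertices the elements $v^g$ of $A(\Gamma)$ ($v\in V(\Gamma)$, $g\in A(\Gamma)$), two distinct vertices being adjacent exactly when they commute in $A(\Gamma)$; $A(\Gamma)$ acts on it by $g\colon x\mapsto x^g$. For $\Gamma$ connected, the asymptotic translation length of $g\in A(\Gamma)$ is $\tau(g)=\lim_{n\to\infty} d(x,x^{g^n})/n$, where $d$ is the edge metric of $\Gamma^e$ and $x$ is any vertex of $\Gamma^e$ (the limit exists and does not depend on $x$), and $g$ is called loxodromic if $\tau(g)>0$. Let $C_k$ be the cycle of length $k\ge 6$, with vertices $v_a$ indexed by residues $a \in \mathbb{Z}/k\mathbb{Z}$ and $v_a$ adjacent to $v_{a+1}$. 1. If $k$ is even, then $\tau(g)\in\mathbb{Z}$ for every $g\in A(C_k)$. 2. If $k$ is odd, then $\tau(g)\in\frac12\mathbb{Z}$ for every $g\in A(C_k)$. Moreover, with $l=(k+1)/2$,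 the element $g=v_{kl}\,v_{(k-1)l}\cdots v_{2l}\,v_l$ of $A(C_k)$ has $\tau(g)=k(k-4)/2$; this number is positive and not an integer, so $g$ is a loxodromic of non-integer asymptotic translation length. -/

import Mathlib

namespace CycleSpectrum

open Filter Topology
open scoped commutatorElement

/-- The right-angled Artin group `A(Γ)`: one generator for each vertex of `Γ`, and one relation
`[u, v] = 1` for each edge `{u, v}` of `Γ`. -/
abbrev RAAG {V : Type*} (Γ : SimpleGraph V) : Type _ :=
  PresentedGroup
    {r : FreeGroup V | ∃ u v : V, Γ.Adj u v ∧ r = ⁅FreeGroup.of u, FreeGroup.of v⁆}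

/-- The generator of `A(Γ)` that corresponds to the vertex `v`. -/
def gen {V : Type*} (Γ : SimpleGraph V) (v : V) : RAAG Γ := PresentedGroup.of v

/-- The vertices of the extension graph `Γᵉ`: the elements `v ^ g = g⁻¹ v g` of `A(Γ)`, where `v`
is a vertex of `Γ` and `g` an element of `A(Γ)`. -/
def ExtVertex {V : Type*} (Γ : SimpleGraph V) : Type _ :=
  {x : RAAG Γ // ∃ (v : V) (g : RAAG Γ), x = g⁻¹ * gen Γ v * g}

/-- The extension graph `Γᵉ`: two distinct vertices are adjacent exactly when they commute as
elements of `A(Γ)`. -/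
def extensionGraph {V : Type*} (Γ : SimpleGraph V) : SimpleGraph (ExtVertex Γ) where
  Adj x y := x ≠ y ∧ Commute x.1 y.1
  symm := ⟨fun _ _ h => ⟨h.1.symm, h.2.symm⟩⟩
  loopless := ⟨fun _ h => h.1 rfl⟩

/-- The (right) action of `A(Γ)` on the vertices of `Γᵉ`: `g` sends `x` to `x ^ g = g⁻¹ x g`. -/
def ExtVertex.conj {V : Type*} {Γ : SimpleGraph V} (x : ExtVertex Γ) (g : RAAG Γ) : ExtVertex Γ :=
  ⟨g⁻¹ * x.1 * g, by
    obtain ⟨v, h, hx⟩ := x.2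
    exact ⟨v, h * g, by rw [hx]; group⟩⟩

/-- `g` has asymptotic translation length `t` on `Γᵉ`: for every vertex `x`, the limit of
`d(x, x ^ (g ^ n)) / n` as `n → ∞` exists and equals `t`, where `d` is the edge metric of `Γᵉ`
(which is connected when `Γ` is, see `extensionGraph_connected`). -/
def HasTranslationLength {V : Type*} (Γ : SimpleGraph V) (g : RAAG Γ) (t : ℝ) : Prop :=
  ∀ x : ExtVertex Γ,
    Tendsto (fun n : ℕ => ((extensionGraph Γ).dist x (x.conj (g ^ n)) : ℝ) / (n : ℝ)) atTop (𝓝 t)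

/-- The vertex `v_a` of the cycle `C_k` on the residues modulo `k`: the residue class of `a`. -/
def cycleVertex {k : ℕ} (hk : 0 < k) (a : ℕ) : Fin k := ⟨a % k, Nat.mod_lt a hk⟩

/-- The element `v_{kl} v_{(k-1)l} ⋯ v_{2l} v_l` of `A(C_k)`, where `l = (k + 1) / 2`
(used for odd `k`, where the division is exact). -/
def oddCycleElement {k : ℕ} (hk : 0 < k) : RAAG (SimpleGraph.cycleGraph k) :=
  ((List.range k).map fun i =>
    gen (SimpleGraph.cycleGraph k) (cycleVertex hk ((k - i) * ((k + 1) / 2)))).prod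

section Connectivity

variable {V : Type*} {Γ : SimpleGraph V}

/-- The vertex `v` of `Γ`, as a vertex of `Γᵉ`. -/
def baseVertex (Γ : SimpleGraph V) (v : V) : ExtVertex Γ := ⟨gen Γ v, v, 1, by simp⟩

theorem gen_commute {u v : V} (h : Γ.Adj u v) : Commute (gen Γ u) (gen Γ v) := by
  rw [← commutatorElement_eq_one_iff_commute]
  exact PresentedGroup.one_of_mem (rels := {r : FreeGroup V | ∃ u v : V, Γ.Adj u v ∧
    r = ⁅FreeGroup.of u, FreeGroup.of v⁆}) ⟨u, v, h, rfl⟩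

theorem gen_injective (Γ : SimpleGraph V) : Function.Injective (gen Γ) := by
  let φ : RAAG Γ →* Multiplicative (V →₀ ℤ) :=
    PresentedGroup.toGroup (f := fun v => Multiplicative.ofAdd (Finsupp.single v 1)) (by
      rintro r ⟨u, v, -, rfl⟩
      rw [map_commutatorElement, commutatorElement_eq_one_iff_commute]
      exact Commute.all _ _)
  have hφ : ∀ v, φ (gen Γ v) = Multiplicative.ofAdd (Finsupp.single v 1) :=
    fun v => PresentedGroup.toGroup.of _
  intro u v h
  have h2 := congrArg φ h
  rw [hφ, hφ] at h2
  exact Finsupp.single_left_injective one_ne_zero (Multiplicative.ofAdd.injective h2)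

theorem conj_reachable {x y : ExtVertex Γ} (g : RAAG Γ)
    (h : (extensionGraph Γ).Reachable x y) :
    (extensionGraph Γ).Reachable (x.conj g) (y.conj g) := by
  refine h.map ⟨fun z => z.conj g, ?_⟩
  rintro a b ⟨hab, hc⟩
  refine ⟨fun h => hab (Subtype.ext ?_), ?_⟩
  · have := congrArg Subtype.val h
    simpa [ExtVertex.conj] using this
  · have := hc.map (MulAut.conj g⁻¹)
    simpa [ExtVertex.conj] using this

theorem baseVertex_reachable (hΓ : Γ.Connected) (u v : V) :
    (extensionGraph Γ).Reachable (baseVertex Γ u) (baseVertex Γ v) := by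
  refine (hΓ.preconnected u v).map ⟨baseVertex Γ, ?_⟩
  intro a b hab
  exact ⟨fun h => hab.ne (gen_injective Γ (congrArg Subtype.val h)), gen_commute hab⟩

theorem baseVertex_conj_reachable (hΓ : Γ.Connected) (g : RAAG Γ) :
    ∀ v, (extensionGraph Γ).Reachable ((baseVertex Γ v).conj g) (baseVertex Γ v) := by
  have conj_conj : ∀ (x : ExtVertex Γ) (a b : RAAG Γ), (x.conj a).conj b = x.conj (a * b) := by
    intro x a b
    apply Subtype.ext
    simp [ExtVertex.conj, mul_assoc]
  have hg : g ∈ Subgroup.closure (Set.range (gen Γ)) := by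
    have := PresentedGroup.closure_range_of {r : FreeGroup V | ∃ u v : V, Γ.Adj u v ∧
      r = ⁅FreeGroup.of u, FreeGroup.of v⁆}
    exact this.symm ▸ Subgroup.mem_top g
  induction hg using Subgroup.closure_induction with
  | mem x hx =>
    obtain ⟨w, rfl⟩ := hx
    intro v
    have h1 := conj_reachable (gen Γ w) (baseVertex_reachable hΓ v w)
    have h2 : (baseVertex Γ w).conj (gen Γ w) = baseVertex Γ w := by
      apply Subtype.ext
      simp [ExtVertex.conj, baseVertex]
    rw [h2] at h1
    exact h1.trans (baseVertex_reachable hΓ w v)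
  | one =>
    intro v
    have h2 : (baseVertex Γ v).conj 1 = baseVertex Γ v := by
      apply Subtype.ext
      simp [ExtVertex.conj]
    rw [h2]
  | mul x y _ _ hx hy =>
    intro v
    rw [← conj_conj]
    exact (conj_reachable y (hx v)).trans (hy v)
  | inv x _ hx =>
    intro v
    have h1 := conj_reachable x⁻¹ (hx v)
    have h2 : (baseVertex Γ v).conj 1 = baseVertex Γ v := by
      apply Subtype.ext
      simp [ExtVertex.conj]
    rw [conj_conj, mul_inv_cancel, h2] at h1
    exact h1.symm

/-- The extension graph of a connected graph is connected, so that its edge metric is finite. -/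
theorem extensionGraph_connected (hΓ : Γ.Connected) : (extensionGraph Γ).Connected := by
  have key : ∀ (x : ExtVertex Γ) (w : V), (extensionGraph Γ).Reachable x (baseVertex Γ w) := by
    intro x w
    obtain ⟨v, g, hx⟩ := x.2
    have h : x = (baseVertex Γ v).conj g := Subtype.ext hx
    rw [h]
    exact (baseVertex_conj_reachable hΓ g v).trans (baseVertex_reachable hΓ v w)
  obtain ⟨w⟩ := hΓ.nonempty
  have : Nonempty (ExtVertex Γ) := ⟨baseVertex Γ w⟩
  exact ⟨fun x y => (key x w).trans (key y w).symm⟩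

end Connectivity

end CycleSpectrum

namespace CycleSpectrum

open Filter Topology
open scoped commutatorElement

/-! ### Words over the generators and swaps of commuting letters -/

variable {V : Type*} {Γ : SimpleGraph V}

/-! Distances in `Γᵉ` reduce to a shortest-walk problem in `Γ`. If a walk in `Γ` from `v` to `u`
meets, in order, the stars of the letters of a word for `g`, then it yields a path of no greater
length from `v^g` to `u`: while standing in the star of a letter, that letter can be stripped off by
conjugation. Conversely, every path in `Γᵉ` yields some word for `g` and such a walk, because
adjacent vertices of `Γᵉ` are simultaneously conjugate to adjacent generators and centralizers of
generators are generated by stars. When stars are thin (`Thin`, true for cycles of length at least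
6), the cost of a word does not change under swaps. Deleting letters never raises it, so any reduced
word of `g` computes the distance (`dist_le_iff_traverses`). This needs the normal form theorem:
reduced words of one element differ by swaps only, which is proved by letting `A(Γ)` act on pilings.

Up to conjugation, `g` has a word `w` all of whose powers are reduced. Unless `w` uses only one
vertex, it can be rotated to end in two letters at different vertices. As degrees are at most two,
an optimal walk may then be assumed to finish each copy of `w` at one of two fixed vertices. A long
walk thus moves between two states, and it decomposes into returns after one or two copies of `w`.
If `T` is the least cost of a return over `w ++ w`, then `τ(g) = T / 2` (`EndsIn.lower_bound`,
`exists_translationLength`). In an even cycle every closed walk has even length, so `T` is even.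

For odd `k = 2m + 1`, the letters of the special element are the residues `0, m, 2m, …`. Two
consecutive letters can be served at cost `(m - 2) + (m - 1) = k - 4`, and a potential on the star
of the current letter shows that no walk does better on average. -/

/-- The element of `A(Γ)` represented by a letter: a vertex together with a sign. -/
def letter (Γ : SimpleGraph V) (x : V × Bool) : RAAG Γ := cond x.2 (gen Γ x.1) (gen Γ x.1)⁻¹

/-- The element of `A(Γ)` represented by a word. -/
def wordVal (Γ : SimpleGraph V) (w : List (V × Bool)) : RAAG Γ := (w.map (letter Γ)).prod

/-- The formal inverse of a letter. -/
def flipSign (x : V × Bool) : V × Bool := (x.1, !x.2)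

@[simp] theorem flipSign_flipSign (x : V × Bool) : flipSign (flipSign x) = x := by simp [flipSign]

@[simp] theorem wordVal_nil : wordVal Γ [] = 1 := rfl

@[simp] theorem wordVal_cons (x : V × Bool) (w : List (V × Bool)) :
    wordVal Γ (x :: w) = letter Γ x * wordVal Γ w := by simp [wordVal]

@[simp] theorem wordVal_append (w w' : List (V × Bool)) :
    wordVal Γ (w ++ w') = wordVal Γ w * wordVal Γ w' := by simp [wordVal]

theorem letter_flipSign (x : V × Bool) : letter Γ (flipSign x) = (letter Γ x)⁻¹ := by
  obtain ⟨a, _ | _⟩ := x <;> simp [letter, flipSign]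

theorem wordVal_replicate (w : List (V × Bool)) (n : ℕ) :
    wordVal Γ (List.replicate n w).flatten = wordVal Γ w ^ n := by
  induction n with
  | zero => simp
  | succ n ih => simp [List.replicate_succ, ih, pow_succ']

theorem letter_commute {x y : V × Bool} (h : Γ.Adj x.1 y.1) :
    Commute (letter Γ x) (letter Γ y) := by
  have := gen_commute h
  obtain ⟨a, _ | _⟩ := x <;> obtain ⟨b, _ | _⟩ := y <;> simpa [letter] using this

theorem wordVal_reverse (w : List (V × Bool)) :
    wordVal Γ (w.map flipSign).reverse = (wordVal Γ w)⁻¹ := by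
  induction w with
  | nil => simp
  | cons x w ih => simp [ih, letter_flipSign]

theorem exists_wordVal (g : RAAG Γ) : ∃ w, wordVal Γ w = g := by
  have hg : g ∈ Subgroup.closure (Set.range (gen Γ)) := by
    have := PresentedGroup.closure_range_of {r : FreeGroup V | ∃ u v : V, Γ.Adj u v ∧
      r = ⁅FreeGroup.of u, FreeGroup.of v⁆}
    exact this.symm ▸ Subgroup.mem_top g
  induction hg using Subgroup.closure_induction with
  | mem x hx => obtain ⟨v, rfl⟩ := hx; exact ⟨[(v, true)], by simp [letter]⟩
  | one => exact ⟨[], rfl⟩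
  | mul x y _ _ hx hy =>
    obtain ⟨w, rfl⟩ := hx
    obtain ⟨w', rfl⟩ := hy
    exact ⟨w ++ w', by simp⟩
  | inv x _ hx =>
    obtain ⟨w, rfl⟩ := hx
    exact ⟨(w.map flipSign).reverse, wordVal_reverse w⟩

/-- Words that differ by swaps of neighbouring letters whose vertices are adjacent. -/
inductive SwapEquiv (Γ : SimpleGraph V) : List (V × Bool) → List (V × Bool) → Prop
  | refl (w) : SwapEquiv Γ w w
  | cons (x) {w w'} : SwapEquiv Γ w w' → SwapEquiv Γ (x :: w) (x :: w')
  | swap {x y} (w) : Γ.Adj x.1 y.1 → SwapEquiv Γ (x :: y :: w) (y :: x :: w)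
  | trans {w₁ w₂ w₃} : SwapEquiv Γ w₁ w₂ → SwapEquiv Γ w₂ w₃ → SwapEquiv Γ w₁ w₃

namespace SwapEquiv

theorem symm {w w' : List (V × Bool)} (h : SwapEquiv Γ w w') : SwapEquiv Γ w' w := by
  induction h with
  | refl w => exact .refl w
  | cons x _ ih => exact .cons x ih
  | swap w h => exact .swap w h.symm
  | trans _ _ ih₁ ih₂ => exact ih₂.trans ih₁

theorem wordVal_eq {w w' : List (V × Bool)} (h : SwapEquiv Γ w w') :
    wordVal Γ w = wordVal Γ w' := by
  induction h with
  | refl w => rfl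
  | cons x _ ih => simp [ih]
  | swap w h => simp [← mul_assoc, (letter_commute h).eq]
  | trans _ _ ih₁ ih₂ => exact ih₁.trans ih₂

theorem length_eq {w w' : List (V × Bool)} (h : SwapEquiv Γ w w') : w.length = w'.length := by
  induction h with
  | refl w => rfl
  | cons x _ ih => simp [ih]
  | swap w h => simp
  | trans _ _ ih₁ ih₂ => exact ih₁.trans ih₂

end SwapEquiv

/-! ### Pilings and reduced words -/

open Classical in
/-- The column of the vertex `b` in the piling of a word: the letters `b ^ ± 1` leave their sign,
the letters of other vertices that are not adjacent to `b` leave a neutral mark. -/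
noncomputable def stack (Γ : SimpleGraph V) (w : List (V × Bool)) (b : V) : List (Option Bool) :=
  w.filterMap fun x => if x.1 = b then some (some x.2) else if Γ.Adj b x.1 then none else some none

theorem stack_cons_self (a : V) (e : Bool) (w : List (V × Bool)) :
    stack Γ ((a, e) :: w) a = some e :: stack Γ w a := by simp [stack]

theorem stack_cons_adj {x : V × Bool} {b : V} (h : Γ.Adj x.1 b) (w : List (V × Bool)) :
    stack Γ (x :: w) b = stack Γ w b := by
  simp [stack, h.ne, h.symm]

theorem stack_cons_of_ne {x : V × Bool} {b : V} (h : ¬ Γ.Adj x.1 b) (hb : x.1 ≠ b)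
    (w : List (V × Bool)) : stack Γ (x :: w) b = none :: stack Γ w b := by
  have : ¬ Γ.Adj b x.1 := fun h' => h h'.symm
  simp [stack, hb, this]

theorem stack_append (w w' : List (V × Bool)) (b : V) :
    stack Γ (w ++ w') b = stack Γ w b ++ stack Γ w' b := by simp [stack]

theorem stack_replicate (w : List (V × Bool)) (n : ℕ) (b : V) :
    stack Γ (List.replicate n w).flatten b = (List.replicate n (stack Γ w b)).flatten := by
  induction n with
  | zero => simp [stack]
  | succ n ih => simp [List.replicate_succ, stack_append, ih]

/-- If two adjacent letters both mark a column, both marks are neutral, so their order cannot be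
seen. -/
theorem SwapEquiv.stack_eq {w w' : List (V × Bool)} (h : SwapEquiv Γ w w') :
    stack Γ w = stack Γ w' := by
  induction h with
  | refl w => rfl
  | @cons x w w' _ ih =>
    funext b
    have := congrFun ih b
    by_cases h1 : Γ.Adj x.1 b
    · rw [stack_cons_adj h1, stack_cons_adj h1, this]
    · by_cases h2 : x.1 = b
      · obtain ⟨a, e⟩ := x
        obtain rfl : a = b := h2
        rw [stack_cons_self, stack_cons_self, this]
      · rw [stack_cons_of_ne h1 h2, stack_cons_of_ne h1 h2, this]
  | @swap x y w h =>
    funext b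
    by_cases h1 : Γ.Adj x.1 b
    · by_cases h2 : Γ.Adj y.1 b
      · simp only [stack_cons_adj h1, stack_cons_adj h2]
      · by_cases h3 : y.1 = b
        · obtain ⟨a, e⟩ := y
          obtain rfl : a = b := h3
          simp only [stack_cons_self, stack_cons_adj h1]
        · simp only [stack_cons_adj h1, stack_cons_of_ne h2 h3]
    · by_cases h1' : x.1 = b
      · obtain ⟨a, e⟩ := x
        obtain rfl : a = b := h1'
        simp only [stack_cons_self, stack_cons_adj h.symm]
      · by_cases h2 : Γ.Adj y.1 b
        · simp only [stack_cons_of_ne h1 h1', stack_cons_adj h2]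
        · have h3 : y.1 ≠ b := fun h3 => h1 (h3 ▸ h)
          simp only [stack_cons_of_ne h1 h1', stack_cons_of_ne h2 h3]
  | trans _ _ ih₁ ih₂ => exact ih₁.trans ih₂

/-- Two neighbouring marks of a column that do not cancel. -/
def NoCancel (p q : Option Bool) : Prop := ∀ e, p = some e → q ≠ some (!e)

/-- A word is reduced when no two neighbouring marks cancel in any column of its piling. -/
def Reduced (Γ : SimpleGraph V) (w : List (V × Bool)) : Prop :=
  ∀ b, (stack Γ w b).IsChain NoCancel

theorem reduced_nil : Reduced Γ [] := fun b => by simp [stack]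

theorem Reduced.of_cons {x : V × Bool} {w : List (V × Bool)} (h : Reduced Γ (x :: w)) :
    Reduced Γ w := by
  intro b
  have hb := h b
  by_cases h1 : Γ.Adj x.1 b
  · rwa [stack_cons_adj h1] at hb
  · by_cases h2 : x.1 = b
    · obtain ⟨a, e⟩ := x
      obtain rfl : a = b := h2
      rw [stack_cons_self] at hb
      exact hb.tail
    · rw [stack_cons_of_ne h1 h2] at hb
      exact hb.tail

/-- Only the column of the new letter's own vertex needs checking, since neutral marks never cancel.
-/
theorem reduced_cons {x : V × Bool} {w : List (V × Bool)} (hw : Reduced Γ w)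
    (h : (stack Γ w x.1).head? ≠ some (some (!x.2))) : Reduced Γ (x :: w) := by
  intro b
  have hb := hw b
  by_cases h1 : Γ.Adj x.1 b
  · rwa [stack_cons_adj h1]
  · by_cases h2 : x.1 = b
    · obtain ⟨a, e⟩ := x
      obtain rfl : a = b := h2
      rw [stack_cons_self]
      refine List.isChain_cons.2 ⟨?_, hb⟩
      rintro y hy e' he' rfl
      cases he'
      exact h hy
    · rw [stack_cons_of_ne h1 h2]
      refine List.isChain_cons.2 ⟨?_, hb⟩
      rintro y hy e' he'
      cases he'

theorem Reduced.head_ne {x : V × Bool} {w : List (V × Bool)} (h : Reduced Γ (x :: w)) :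
    (stack Γ w x.1).head? ≠ some (some (!x.2)) := by
  obtain ⟨a, e⟩ := x
  have := h a
  rw [stack_cons_self, List.isChain_cons] at this
  exact fun hh => this.1 _ hh e rfl rfl

theorem Reduced.congr {w w' : List (V × Bool)} (hw : Reduced Γ w) (h : stack Γ w = stack Γ w') :
    Reduced Γ w' := fun b => h ▸ hw b

/-- All letters before the first mark of column `a` are adjacent to `a`, so the letter can be moved
past them. -/
theorem exists_front {w : List (V × Bool)} {a : V} {e : Bool}
    (h : (stack Γ w a).head? = some (some e)) : ∃ w', SwapEquiv Γ w ((a, e) :: w') := by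
  induction w with
  | nil => simp [stack] at h
  | cons y w ih =>
    by_cases h1 : Γ.Adj y.1 a
    · rw [stack_cons_adj h1] at h
      obtain ⟨w', hw'⟩ := ih h
      exact ⟨y :: w', (hw'.cons y).trans (.swap _ h1)⟩
    · by_cases h2 : y.1 = a
      · obtain ⟨b, e'⟩ := y
        obtain rfl : b = a := h2
        rw [stack_cons_self] at h
        obtain rfl : e' = e := by simpa using h
        exact ⟨w, .refl _⟩
      · rw [stack_cons_of_ne h1 h2] at h
        simp at h

theorem swapEquiv_append_singleton {x : V × Bool} {w : List (V × Bool)}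
    (h : stack Γ w x.1 = []) : SwapEquiv Γ (x :: w) (w ++ [x]) := by
  induction w with
  | nil => exact .refl _
  | cons y w ih =>
    by_cases h1 : Γ.Adj y.1 x.1
    · rw [stack_cons_adj h1] at h
      exact (SwapEquiv.swap _ h1.symm).trans ((ih h).cons y)
    · by_cases h2 : y.1 = x.1
      · obtain ⟨b, e'⟩ := y
        obtain rfl : b = x.1 := h2
        rw [stack_cons_self] at h
        simp at h
      · rw [stack_cons_of_ne h1 h2] at h
        simp at h

theorem exists_back {w : List (V × Bool)} {a : V} {e : Bool}
    (h : (stack Γ w a).getLast? = some (some e)) : ∃ w', SwapEquiv Γ w (w' ++ [(a, e)]) := by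
  induction w with
  | nil => simp [stack] at h
  | cons y w ih =>
    by_cases hw : stack Γ w a = []
    · by_cases h1 : Γ.Adj y.1 a
      · rw [stack_cons_adj h1, hw] at h
        simp at h
      · by_cases h2 : y.1 = a
        · obtain ⟨b, e'⟩ := y
          obtain rfl : b = a := h2
          rw [stack_cons_self, hw] at h
          obtain rfl : e' = e := by simpa using h
          exact ⟨w, swapEquiv_append_singleton hw⟩
        · rw [stack_cons_of_ne h1 h2, hw] at h
          simp at h
    · have : (stack Γ w a).getLast? = some (some e) := by
        rw [← h]
        by_cases h1 : Γ.Adj y.1 a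
        · rw [stack_cons_adj h1]
        · by_cases h2 : y.1 = a
          · obtain ⟨b, e'⟩ := y
            obtain rfl : b = a := h2
            rw [stack_cons_self, List.getLast?_cons, List.getLast?_eq_some_getLast hw]
            simp
          · rw [stack_cons_of_ne h1 h2, List.getLast?_cons, List.getLast?_eq_some_getLast hw]
            simp
      obtain ⟨w', hw'⟩ := ih this
      exact ⟨y :: w', hw'.cons y⟩

/-- The first letter of `w` heads its own column, so it can be brought to the front of `w'` as well;
then induct on the rest. -/
theorem swapEquiv_of_stack_eq {w w' : List (V × Bool)} (h : stack Γ w = stack Γ w') :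
    SwapEquiv Γ w w' := by
  induction w generalizing w' with
  | nil =>
    cases w' with
    | nil => exact .refl _
    | cons x w' =>
      obtain ⟨a, e⟩ := x
      have := congrFun h a
      rw [stack_cons_self] at this
      simp [stack] at this
  | cons x w ih =>
    obtain ⟨a, e⟩ := x
    obtain ⟨t, ht⟩ := exists_front (Γ := Γ) (w := w') (a := a) (e := e) (by
      rw [← h, stack_cons_self]; rfl)
    rw [ht.stack_eq] at h
    refine .trans (.cons _ (ih ?_)) ht.symm
    funext b
    have hb := congrFun h b
    by_cases h1 : Γ.Adj a b
    · rwa [stack_cons_adj h1, stack_cons_adj h1] at hb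
    · by_cases h2 : a = b
      · subst h2
        rw [stack_cons_self, stack_cons_self] at hb
        exact (List.cons.inj hb).2
      · rw [stack_cons_of_ne h1 h2, stack_cons_of_ne h1 h2] at hb
        exact (List.cons.inj hb).2

/-! ### The action on pilings and the normal form theorem -/

/-- The pilings of the reduced words. -/
def Piling (Γ : SimpleGraph V) : Type _ :=
  {σ : V → List (Option Bool) // ∃ w, Reduced Γ w ∧ σ = stack Γ w}

/-- The piling of a reduced word. -/
noncomputable def Reduced.piling {w : List (V × Bool)} (h : Reduced Γ w) : Piling Γ :=
  ⟨stack Γ w, w, h, rfl⟩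

open Classical in
/-- Multiplication of a piling by a letter: cancel if possible, otherwise add the letter. -/
noncomputable def rawAct (Γ : SimpleGraph V) (x : V × Bool) (σ : V → List (Option Bool)) :
    V → List (Option Bool) := fun b =>
  if Γ.Adj x.1 b then σ b
  else if (σ x.1).head? = some (some (!x.2)) then (σ b).tail
  else if x.1 = b then some x.2 :: σ b
  else none :: σ b

theorem rawAct_push {x : V × Bool} {w : List (V × Bool)} (h : Reduced Γ (x :: w)) :
    rawAct Γ x (stack Γ w) = stack Γ (x :: w) := by
  funext b
  have := h.head_ne
  by_cases h1 : Γ.Adj x.1 b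
  · simp [rawAct, stack_cons_adj h1, h1]
  · by_cases h2 : x.1 = b
    · obtain ⟨a, e⟩ := x
      obtain rfl : a = b := h2
      simp [rawAct, stack_cons_self, this]
    · simp [rawAct, stack_cons_of_ne h1 h2, this, h1, h2]

theorem rawAct_pop {x : V × Bool} {w : List (V × Bool)} :
    rawAct Γ x (stack Γ (flipSign x :: w)) = stack Γ w := by
  funext b
  have hx : (stack Γ (flipSign x :: w) x.1).head? = some (some (!x.2)) := by
    simp only [flipSign, stack_cons_self, List.head?_cons]
  by_cases h1 : Γ.Adj x.1 b
  · simp only [rawAct, h1, if_true]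
    exact stack_cons_adj (x := flipSign x) h1 w
  · simp only [rawAct, h1, hx, if_false, if_true]
    by_cases h2 : x.1 = b
    · subst h2
      simp only [flipSign, stack_cons_self, List.tail_cons]
    · rw [stack_cons_of_ne (x := flipSign x) h1 h2, List.tail_cons]

theorem Reduced.push_or_pop {w : List (V × Bool)} (hw : Reduced Γ w) (x : V × Bool) :
    Reduced Γ (x :: w) ∨ ∃ w', SwapEquiv Γ w (flipSign x :: w') ∧ Reduced Γ (flipSign x :: w') := by
  by_cases h : (stack Γ w x.1).head? = some (some (!x.2))
  · obtain ⟨w', hw'⟩ := exists_front h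
    exact Or.inr ⟨w', hw', hw.congr hw'.stack_eq⟩
  · exact Or.inl (reduced_cons hw h)

/-- Multiplication of a piling by a letter. -/
noncomputable def Piling.act (x : V × Bool) (σ : Piling Γ) : Piling Γ :=
  ⟨rawAct Γ x σ.1, by
    obtain ⟨_, w, hw, rfl⟩ := σ
    rcases hw.push_or_pop x with h | ⟨w', h, h'⟩
    · exact ⟨x :: w, h, rawAct_push h⟩
    · exact ⟨w', h'.of_cons, by simp only [h.stack_eq, rawAct_pop]⟩⟩

theorem Piling.act_act_flipSign (x : V × Bool) (σ : Piling Γ) : (σ.act x).act (flipSign x) = σ := by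
  obtain ⟨_, w, hw, rfl⟩ := σ
  apply Subtype.ext
  simp only [Piling.act]
  rcases hw.push_or_pop x with h | ⟨w', h, h'⟩
  · rw [rawAct_push h]
    have := rawAct_pop (Γ := Γ) (x := flipSign x) (w := w)
    rwa [flipSign_flipSign] at this
  · rw [h.stack_eq, rawAct_pop, rawAct_push h']

theorem Reduced.swap {x y : V × Bool} (h : Γ.Adj x.1 y.1) {w : List (V × Bool)}
    (hx : Reduced Γ (x :: w)) (hy : Reduced Γ (y :: w)) : Reduced Γ (x :: y :: w) := by
  refine reduced_cons hy ?_
  rw [stack_cons_adj h.symm]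
  exact hx.head_ne

/-- Neither letter touches the other's column, so whether one is pushed or popped does not depend on
the other. By symmetry, the case where `x` is pushed and `y` popped can be left out. -/
theorem Piling.act_comm {x y : V × Bool} (h : Γ.Adj x.1 y.1) (σ : Piling Γ) :
    (σ.act x).act y = (σ.act y).act x := by
  wlog hp : ∀ w, Reduced Γ w → σ.1 = stack Γ w → Reduced Γ (x :: w) → Reduced Γ (y :: w)
    generalizing x y
  · refine (this h.symm ?_).symm
    push Not at hp
    obtain ⟨w, hw, hs, hx, -⟩ := hp
    intro w' hw' hs' hy'
    exact reduced_cons hw' (by rw [← hs', hs]; exact hx.head_ne)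
  obtain ⟨_, w, hw, rfl⟩ := σ
  apply Subtype.ext
  simp only [Piling.act]
  rcases hw.push_or_pop x with hx | ⟨w', hx, hx'⟩
  · have hy := hp w hw rfl hx
    rw [rawAct_push hx, rawAct_push hy, rawAct_push (hx.swap h hy),
      rawAct_push (hy.swap h.symm hx)]
    exact (SwapEquiv.swap w h.symm).stack_eq
  · have h' : Γ.Adj y.1 (flipSign x).1 := h.symm
    rw [hx.stack_eq, rawAct_pop]
    rcases hx'.of_cons.push_or_pop y with hy | ⟨w'', hy, hy'⟩
    · rw [rawAct_push hy, rawAct_push (hy.swap h' hx'), (SwapEquiv.swap w' h').stack_eq,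
        rawAct_pop]
    · rw [((hy.cons _).trans (SwapEquiv.swap w'' (x := flipSign x) (y := flipSign y) h)).stack_eq,
        rawAct_pop, hy.stack_eq, rawAct_pop, rawAct_pop]

/-- Multiplication of pilings by a vertex, as a permutation. -/
noncomputable def Piling.perm (Γ : SimpleGraph V) (v : V) : Equiv.Perm (Piling Γ) where
  toFun := Piling.act (v, true)
  invFun := Piling.act (v, false)
  left_inv σ := σ.act_act_flipSign (v, true)
  right_inv σ := σ.act_act_flipSign (v, false)

/-- The action of `A(Γ)` on the pilings of the reduced words. -/
noncomputable def Piling.hom (Γ : SimpleGraph V) : RAAG Γ →* Equiv.Perm (Piling Γ) :=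
  PresentedGroup.toGroup (f := Piling.perm Γ) (by
    rintro r ⟨u, v, h, rfl⟩
    rw [map_commutatorElement, commutatorElement_eq_one_iff_commute]
    ext σ : 1
    simp only [FreeGroup.lift_apply_of, Equiv.Perm.coe_mul, Function.comp_apply]
    exact Piling.act_comm (x := (v, true)) (y := (u, true)) h.symm σ)

theorem Piling.hom_letter (x : V × Bool) (σ : Piling Γ) :
    Piling.hom Γ (letter Γ x) σ = σ.act x := by
  have h : ∀ v, Piling.hom Γ (gen Γ v) = Piling.perm Γ v := fun v => PresentedGroup.toGroup.of _
  obtain ⟨v, _ | _⟩ := x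
  · simp only [letter, cond_false, map_inv, h]; rfl
  · simp only [letter, cond_true, h]; rfl

/-- Acting on the empty piling only ever pushes, as every suffix of `w` is reduced. Hence the group
element determines the piling. -/
theorem Piling.hom_wordVal {w : List (V × Bool)} (hw : Reduced Γ w) :
    Piling.hom Γ (wordVal Γ w) reduced_nil.piling = hw.piling := by
  induction w with
  | nil => simp
  | cons x w ih =>
    rw [wordVal_cons, map_mul, Equiv.Perm.mul_apply, ih hw.of_cons, Piling.hom_letter]
    exact Subtype.ext (rawAct_push hw)

/-- Reduced words of the same element differ by swaps only. -/
theorem Reduced.swapEquiv {w w' : List (V × Bool)} (hw : Reduced Γ w) (hw' : Reduced Γ w')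
    (h : wordVal Γ w = wordVal Γ w') : SwapEquiv Γ w w' := by
  apply swapEquiv_of_stack_eq
  have := Piling.hom_wordVal hw
  rw [h, Piling.hom_wordVal hw'] at this
  exact (congrArg Subtype.val this).symm

/-- Every word `w` can be reduced, and its reduced form is `R`-related to it for every transitive
relation `R` that contains swaps and deletions of letters and is stable under adding a first letter.
The reduced form is shorter than `w` or differs from it by swaps only. -/
theorem exists_reduced (R : List (V × Bool) → List (V × Bool) → Prop)
    (hswap : ∀ w w', SwapEquiv Γ w w' → R w w')
    (hcons : ∀ x w w', R w w' → R (x :: w) (x :: w'))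
    (hdel : ∀ x w, R (x :: w) w) (htrans : ∀ w₁ w₂ w₃, R w₁ w₂ → R w₂ w₃ → R w₁ w₃)
    (w : List (V × Bool)) : ∃ r, Reduced Γ r ∧ wordVal Γ r = wordVal Γ w ∧ R w r ∧
      (r.length < w.length ∨ SwapEquiv Γ w r) := by
  induction w with
  | nil => exact ⟨[], reduced_nil, rfl, hswap _ _ (.refl _), Or.inr (.refl _)⟩
  | cons x w ih =>
    obtain ⟨r, hr, hv, hR, hl⟩ := ih
    rcases hr.push_or_pop x with h | ⟨w', h, h'⟩
    · refine ⟨x :: r, h, by simp [hv], hcons _ _ _ hR, ?_⟩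
      rcases hl with hl | hl
      · exact Or.inl (by simpa using hl)
      · exact Or.inr (hl.cons x)
    · refine ⟨w', h'.of_cons, ?_, ?_, Or.inl ?_⟩
      · rw [wordVal_cons, ← hv, h.wordVal_eq, wordVal_cons, letter_flipSign]
        group
      · exact htrans _ _ _ (hdel _ _)
          (htrans _ _ _ hR (htrans _ _ _ (hswap _ _ h) (hdel _ _)))
      · have h1 := h.length_eq
        have h2 : r.length ≤ w.length := hl.elim le_of_lt fun h => h.length_eq.ge
        simp only [List.length_cons] at h1 ⊢
        omega

/-! ### Cyclically minimal words and their powers -/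

/-- A word that is as short as every word of every conjugate. -/
def CyclicallyMinimal (Γ : SimpleGraph V) (w : List (V × Bool)) : Prop :=
  ∀ (h : RAAG Γ) (w' : List (V × Bool)),
    wordVal Γ w' = h * wordVal Γ w * h⁻¹ → w.length ≤ w'.length

theorem exists_cyclicallyMinimal (g : RAAG Γ) :
    ∃ (h : RAAG Γ) (w : List (V × Bool)), wordVal Γ w = h * g * h⁻¹ ∧ CyclicallyMinimal Γ w := by
  classical
  have hex : ∃ n, ∃ (h : RAAG Γ) (w : List (V × Bool)), wordVal Γ w = h * g * h⁻¹ ∧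
      w.length = n := by
    obtain ⟨w, hw⟩ := exists_wordVal g
    exact ⟨_, 1, w, by simpa using hw, rfl⟩
  obtain ⟨h, w, hw, hl⟩ := Nat.find_spec hex
  refine ⟨h, w, hw, fun h' w' hw' => ?_⟩
  rw [hl]
  exact Nat.find_min' hex ⟨h' * h, w', by rw [hw', hw]; group, rfl⟩

theorem CyclicallyMinimal.rotate {w w' : List (V × Bool)}
    (h : CyclicallyMinimal Γ (w ++ w')) : CyclicallyMinimal Γ (w' ++ w) := by
  intro g u hu
  have := h (g * (wordVal Γ w)⁻¹) u (by rw [hu]; simp [mul_assoc])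
  simpa [add_comm] using this

theorem CyclicallyMinimal.reduced {w : List (V × Bool)} (h : CyclicallyMinimal Γ w) :
    Reduced Γ w := by
  obtain ⟨r, hr, hv, -, hl⟩ := exists_reduced (Γ := Γ) (fun _ _ => True) (fun _ _ _ => trivial)
    (fun _ _ _ _ => trivial) (fun _ _ => trivial) (fun _ _ _ _ _ => trivial) w
  have h1 := h 1 r (by simp [hv])
  have h2 := hl.resolve_left (by omega)
  exact hr.congr h2.stack_eq.symm

/-- Opposite signs at the two ends of a column could be moved to the two ends of the word and
removed by a conjugation, leaving a word shorter by two letters. -/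
theorem CyclicallyMinimal.noCancel {w : List (V × Bool)} (h : CyclicallyMinimal Γ w) (b : V)
    {p q : Option Bool} (hp : (stack Γ w b).getLast? = some p)
    (hq : (stack Γ w b).head? = some q) : NoCancel p q := by
  rintro e rfl rfl
  obtain ⟨t, ht⟩ := exists_front hq
  rw [ht.stack_eq, stack_cons_self] at hp
  have ht' : (stack Γ t b).getLast? = some (some e) := by
    rw [List.getLast?_cons] at hp
    cases hs : (stack Γ t b).getLast? with
    | none => rw [hs] at hp; simp at hp
    | some y => rw [hs] at hp; simpa using hp
  obtain ⟨u, hu⟩ := exists_back ht'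
  have h1 := h (letter Γ (b, !e))⁻¹ u (by
    rw [ht.wordVal_eq, wordVal_cons, hu.wordVal_eq, wordVal_append]
    have : letter Γ (b, !e) = (letter Γ (b, e))⁻¹ := letter_flipSign (b, e)
    simp [this])
  have h2 := ht.length_eq
  have h3 := hu.length_eq
  simp at h2 h3
  omega

/-- The columns of a power are repeated columns of `w`, so a cancellation could only occur inside
one copy or at a seam. -/
theorem CyclicallyMinimal.reduced_pow {w : List (V × Bool)} (h : CyclicallyMinimal Γ w) (n : ℕ) :
    Reduced Γ (List.replicate n w).flatten := by
  intro b
  rw [stack_replicate]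
  induction n with
  | zero => simp
  | succ n ih =>
    rw [List.replicate_succ, List.flatten_cons]
    refine List.IsChain.append (h.reduced b) ih ?_
    intro p hp q hq
    cases n with
    | zero => simp at hq
    | succ n =>
      refine h.noCancel b hp ?_
      have hne : stack Γ w b ≠ [] := by rintro h0; rw [h0] at hp; simp at hp
      rw [List.replicate_succ, List.flatten_cons, List.head?_append_of_ne_nil _ hne] at hq
      exact hq

/-! ### Centralizers of generators and adjacency in the extension graph -/

/-- `b` lies in the star of `a`. -/
def InStar (Γ : SimpleGraph V) (a b : V) : Prop := b = a ∨ Γ.Adj a b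

theorem InStar.symm {a b : V} (h : InStar Γ a b) : InStar Γ b a :=
  h.imp Eq.symm SimpleGraph.Adj.symm

theorem InStar.refl (a : V) : InStar Γ a a := Or.inl rfl

theorem letter_commute_of_inStar {x y : V × Bool} (h : InStar Γ x.1 y.1) :
    Commute (letter Γ x) (letter Γ y) := by
  rcases h with h | h
  · obtain ⟨a, _ | _⟩ := x <;> obtain ⟨b, _ | _⟩ := y <;> obtain rfl : b = a := h <;> simp [letter]
  · exact letter_commute h

theorem commute_wordVal {v : V} {w : List (V × Bool)} (h : ∀ x ∈ w, InStar Γ v x.1) :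
    Commute (gen Γ v) (wordVal Γ w) := by
  refine Commute.list_prod_right _ _ ?_
  simp only [List.mem_map]
  rintro _ ⟨x, hx, rfl⟩
  exact letter_commute_of_inStar (x := (v, true)) (h x hx)

theorem adj_of_stack_eq_nil {w : List (V × Bool)} {v : V} (h : stack Γ w v = []) :
    ∀ x ∈ w, Γ.Adj v x.1 := by
  intro x hx
  have := List.filterMap_eq_nil_iff.1 h x hx
  by_contra h'
  split_ifs at this

theorem Reduced.append_singleton {w : List (V × Bool)} {x : V × Bool} (hw : Reduced Γ w)
    (h : (stack Γ w x.1).getLast? ≠ some (some (!x.2))) : Reduced Γ (w ++ [x]) := by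
  intro b
  rw [stack_append]
  refine List.IsChain.append (hw b) ?_ ?_
  · by_cases h1 : Γ.Adj x.1 b
    · rw [stack_cons_adj h1]; simp [stack]
    · by_cases h2 : x.1 = b
      · obtain ⟨a, e⟩ := x
        obtain rfl : a = b := h2
        rw [stack_cons_self]; simp [stack]
      · rw [stack_cons_of_ne h1 h2]; simp [stack]
  · rintro p hp q hq e rfl rfl
    by_cases h1 : Γ.Adj x.1 b
    · rw [stack_cons_adj h1] at hq; simp [stack] at hq
    · by_cases h2 : x.1 = b
      · obtain ⟨a, e'⟩ := x
        obtain rfl : a = b := h2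
        rw [stack_cons_self] at hq
        obtain rfl : e' = !e := by simpa using hq
        simp only [Bool.not_not] at h
        exact h hp
      · rw [stack_cons_of_ne h1 h2] at hq; simp at hq

theorem Reduced.of_append_singleton {w : List (V × Bool)} {x : V × Bool}
    (hw : Reduced Γ (w ++ [x])) : Reduced Γ w := fun b =>
  List.IsChain.left_of_append (stack_append (Γ := Γ) w [x] b ▸ hw b)

theorem commute_of_mul_left {G : Type*} [Group G] {a b c : G} (h : Commute a b)
    (h' : Commute a (b * c)) : Commute a c := by
  simpa using h.inv_right.mul_right h'

theorem commute_of_mul_right {G : Type*} [Group G] {a b c : G} (h : Commute a c)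
    (h' : Commute a (b * c)) : Commute a b := by
  simpa using h'.mul_right h.inv_right

/-- The centralizer of a generator is generated by its star. -/
theorem exists_star_word_of_commute {v : V} {g : RAAG Γ} (hg : Commute (gen Γ v) g) :
    ∃ w, wordVal Γ w = g ∧ ∀ x ∈ w, InStar Γ v x.1 := by
  suffices key : ∀ (n : ℕ) (w : List (V × Bool)), w.length ≤ n → Reduced Γ w →
      Commute (gen Γ v) (wordVal Γ w) →
      ∃ w', wordVal Γ w' = wordVal Γ w ∧ ∀ x ∈ w', InStar Γ v x.1 by
    obtain ⟨w, rfl⟩ := exists_wordVal g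
    obtain ⟨r, hr, hv, -⟩ := exists_reduced (Γ := Γ) (fun _ _ => True) (fun _ _ _ => trivial)
      (fun _ _ _ _ => trivial) (fun _ _ => trivial) (fun _ _ _ _ _ => trivial) w
    obtain ⟨w', h1, h2⟩ := key _ r le_rfl hr (hv ▸ hg)
    exact ⟨w', h1.trans hv, h2⟩
  intro n
  induction n with
  | zero =>
    intro w hw _ _
    obtain rfl : w = [] := List.length_eq_zero_iff.1 (by omega)
    exact ⟨[], rfl, by simp⟩
  | succ n ih =>
    intro w hl hw hc
    have hself : ∀ e, Commute (gen Γ v) (letter Γ (v, e)) := fun e =>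
      letter_commute_of_inStar (x := (v, true)) (y := (v, e)) (Or.inl rfl)
    by_cases h1 : ∃ e, (stack Γ w v).head? = some (some e)
    · obtain ⟨e, he⟩ := h1
      obtain ⟨t, ht⟩ := exists_front he
      have hlen := ht.length_eq
      simp only [List.length_cons] at hlen
      rw [ht.wordVal_eq, wordVal_cons] at hc ⊢
      obtain ⟨w', h1, h2⟩ := ih t (by omega) (hw.congr ht.stack_eq).of_cons
        (commute_of_mul_left (hself e) hc)
      refine ⟨(v, e) :: w', by simp [h1], ?_⟩
      rintro x (_ | ⟨_, hx⟩)
      exacts [Or.inl rfl, h2 x hx]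
    · by_cases h2 : ∃ e, (stack Γ w v).getLast? = some (some e)
      · obtain ⟨e, he⟩ := h2
        obtain ⟨t, ht⟩ := exists_back he
        have hlen := ht.length_eq
        simp only [List.length_append, List.length_cons, List.length_nil] at hlen
        rw [ht.wordVal_eq, wordVal_append] at hc ⊢
        obtain ⟨w', h1, h2⟩ := ih t (by omega) (hw.congr ht.stack_eq).of_append_singleton
          (commute_of_mul_right (by simpa using hself e) hc)
        refine ⟨w' ++ [(v, e)], by simp [h1], ?_⟩
        intro x hx
        rcases List.mem_append.1 hx with hx | hx
        · exact h2 x hx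
        · obtain rfl := List.mem_singleton.1 hx
          exact Or.inl rfl
      -- With no sign at either end of column `v`, both `v w` and `w v` are reduced, hence have
      -- equal columns. At `v` this reads `true :: s = s ++ [true]`; a nonempty `s` would then begin
      -- with a sign, so `s` is empty.
      · push Not at h1 h2
        have hf : Reduced Γ ((v, true) :: w) := reduced_cons hw (h1 _)
        have hb : Reduced Γ (w ++ [(v, true)]) := hw.append_singleton (h2 _)
        have := congrFun (hf.swapEquiv hb (by simpa [letter] using hc.eq)).stack_eq v
        rw [stack_append, stack_cons_self, stack_cons_self] at this
        refine ⟨w, rfl, fun x hx => Or.inr (adj_of_stack_eq_nil ?_ x hx)⟩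
        cases hs : stack Γ w v with
        | nil => rfl
        | cons p s =>
          rw [hs] at this
          obtain rfl : some true = p := (List.cons.inj this).1
          exact absurd (by rw [hs]; rfl) (h1 true)

open Classical in
/-- The retraction of `A(Γ)` to the subgroup generated by the star of `v`. -/
noncomputable def starRetraction (Γ : SimpleGraph V) (v : V) : RAAG Γ →* RAAG Γ :=
  PresentedGroup.toGroup (f := fun u => if InStar Γ v u then gen Γ u else 1) (by
    rintro r ⟨a, b, h, rfl⟩
    rw [map_commutatorElement, commutatorElement_eq_one_iff_commute]
    simp only [FreeGroup.lift_apply_of]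
    split_ifs
    · exact gen_commute h
    all_goals simp)

open Classical in
theorem starRetraction_gen (v u : V) :
    starRetraction Γ v (gen Γ u) = if InStar Γ v u then gen Γ u else 1 :=
  PresentedGroup.toGroup.of _

theorem starRetraction_wordVal {v : V} {w : List (V × Bool)} (h : ∀ x ∈ w, InStar Γ v x.1) :
    starRetraction Γ v (wordVal Γ w) = wordVal Γ w := by
  induction w with
  | nil => simp
  | cons x w ih =>
    have hx := h x (by simp)
    rw [wordVal_cons, map_mul, ih fun y hy => h y (by simp [hy])]
    congr 1
    obtain ⟨a, _ | _⟩ := x <;> simp [letter, starRetraction_gen, show InStar Γ v a from hx]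

theorem commute_starRetraction (v : V) (g : RAAG Γ) :
    Commute (gen Γ v) (starRetraction Γ v g) := by
  obtain ⟨w, rfl⟩ := exists_wordVal g
  induction w with
  | nil => simp
  | cons x w ih =>
    rw [wordVal_cons, map_mul]
    refine Commute.mul_right ?_ ih
    have : Commute (gen Γ v) (starRetraction Γ v (gen Γ x.1)) := by
      rw [starRetraction_gen]
      split_ifs with h
      · exact letter_commute_of_inStar (x := (v, true)) (y := (x.1, true)) h
      · simp
    obtain ⟨a, _ | _⟩ := x
    · simpa [letter] using this.inv_right
    · simpa [letter] using this

theorem gen_ne_one (v : V) : gen Γ v ≠ 1 := by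
  let φ : RAAG Γ →* Multiplicative ℤ :=
    PresentedGroup.toGroup (f := fun _ => Multiplicative.ofAdd 1) (by
      rintro r ⟨u, v, -, rfl⟩
      rw [map_commutatorElement, commutatorElement_eq_one_iff_commute]
      exact Commute.all _ _)
  have hφ : φ (gen Γ v) = Multiplicative.ofAdd 1 := PresentedGroup.toGroup.of _
  intro h
  rw [h, map_one] at hφ
  exact absurd (Multiplicative.ofAdd.injective (ofAdd_zero.trans hφ)) zero_ne_one

/-- Two conjugates of generators that are adjacent in the extension graph are conjugate, by one
element, to two adjacent generators. -/
theorem adj_and_commute_of_adj {v v' : V} {c : RAAG Γ} (hne : gen Γ v ≠ c⁻¹ * gen Γ v' * c)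
    (h : Commute (gen Γ v) (c⁻¹ * gen Γ v' * c)) :
    Γ.Adj v v' ∧ ∃ s' s, Commute (gen Γ v') s' ∧ Commute (gen Γ v) s ∧ c = s' * s := by
  obtain ⟨w, hw, hs⟩ := exists_star_word_of_commute h
  -- The conjugate lies in the star subgroup of `v`, so the retraction fixes it; hence `c` and its
  -- image `r` conjugate `v'` to the same element, or `v'` is killed.
  have h1 := starRetraction_wordVal hs
  rw [hw, map_mul, map_mul, map_inv, starRetraction_gen] at h1
  set r := starRetraction Γ v c with hr
  have hrc : Commute (gen Γ v) r := commute_starRetraction v c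
  by_cases hin : InStar Γ v v'
  · rw [if_pos hin] at h1
    refine ⟨hin.resolve_left ?_, c * r⁻¹, r, ?_, hrc, by simp⟩
    · rintro rfl
      apply hne
      rw [← h1, mul_assoc, hrc.eq]
      simp
    · have : r * (r⁻¹ * gen Γ v' * r) * r⁻¹ = r * (c⁻¹ * gen Γ v' * c) * r⁻¹ := by rw [h1]
      have h2 : gen Γ v' = r * c⁻¹ * gen Γ v' * c * r⁻¹ := by simpa [mul_assoc] using this
      change gen Γ v' * (c * r⁻¹) = c * r⁻¹ * gen Γ v'
      conv_rhs => rw [h2]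
      group
  · rw [if_neg hin] at h1
    simp only [mul_one, inv_mul_cancel] at h1
    have : gen Γ v' = 1 := by
      have h2 : c * 1 * c⁻¹ = c * (c⁻¹ * gen Γ v' * c) * c⁻¹ := by rw [← h1]
      simpa [mul_assoc] using h2.symm
    exact absurd this (gen_ne_one v')

/-! ### Walks that meet a sequence of stars -/

/-- `Traverses Γ u l v n`: there is a walk in `Γ` from `u` to `v` of length at most `n` that meets,
in their order, the stars of the vertices of the list `l`. -/
def Traverses (Γ : SimpleGraph V) : V → List V → V → ℕ → Prop
  | u, [], v, n => Γ.dist u v ≤ n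
  | u, a :: l, v, n => ∃ x p, InStar Γ a x ∧ Γ.dist u x + p ≤ n ∧ Traverses Γ x l v p

theorem Traverses.mono {u v : V} {l : List V} {m n : ℕ} (h : Traverses Γ u l v m) (hmn : m ≤ n) :
    Traverses Γ u l v n := by
  cases l with
  | nil => exact le_trans h hmn
  | cons a l =>
    obtain ⟨x, p, hx, hp, h⟩ := h
    exact ⟨x, p, hx, hp.trans hmn, h⟩

theorem Traverses.prepend (hΓ : Γ.Connected) {u u' v : V} {l : List V} {n : ℕ}
    (h : Traverses Γ u l v n) : Traverses Γ u' l v (Γ.dist u' u + n) := by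
  cases l with
  | nil => exact hΓ.dist_triangle.trans (Nat.add_le_add_left h _)
  | cons a l =>
    obtain ⟨x, p, hx, hp, h⟩ := h
    refine ⟨x, p, hx, ?_, h⟩
    have := hΓ.dist_triangle (u := u') (v := u) (w := x)
    omega

theorem traverses_append (hΓ : Γ.Connected) {u v : V} {l l' : List V} {n : ℕ} :
    Traverses Γ u (l ++ l') v n ↔
      ∃ x p q, Traverses Γ u l x p ∧ Traverses Γ x l' v q ∧ p + q ≤ n := by
  induction l generalizing u n with
  | nil =>
    constructor
    · exact fun h => ⟨u, 0, n, by simp [Traverses], h, by simp⟩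
    · rintro ⟨x, p, q, h1, h2, h3⟩
      exact (h2.prepend hΓ (u' := u)).mono (by simp only [Traverses] at h1; omega)
  | cons a l ih =>
    constructor
    · rintro ⟨x, p, hx, hp, h⟩
      obtain ⟨y, q, r, h1, h2, h3⟩ := ih.1 h
      exact ⟨y, Γ.dist u x + q, r, ⟨x, q, hx, le_rfl, h1⟩, h2, by omega⟩
    · rintro ⟨y, q, r, ⟨x, p, hx, hp, h⟩, h2, h3⟩
      exact ⟨x, p + r, hx, by omega, ih.2 ⟨y, p, r, h, h2, le_rfl⟩⟩

theorem Traverses.append (hΓ : Γ.Connected) {u v x : V} {l l' : List V} {p q : ℕ}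
    (h : Traverses Γ u l x p) (h' : Traverses Γ x l' v q) : Traverses Γ u (l ++ l') v (p + q) :=
  (traverses_append hΓ).2 ⟨x, p, q, h, h', le_rfl⟩

theorem Traverses.of_cons (hΓ : Γ.Connected) {u v a : V} {l : List V} {n : ℕ}
    (h : Traverses Γ u (a :: l) v n) : Traverses Γ u l v n := by
  obtain ⟨x, p, hx, hp, h⟩ := h
  exact (h.prepend hΓ).mono hp

theorem traverses_of_inStar {u : V} {l : List V} (h : ∀ a ∈ l, InStar Γ u a) :
    Traverses Γ u l u 0 := by
  induction l with
  | nil => simp [Traverses]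
  | cons a l ih =>
    exact ⟨u, 0, (h a (by simp)).symm, by simp, ih fun b hb => h b (by simp [hb])⟩

/-- Some geodesic between the stars of two adjacent vertices passes through one of the two. -/
def Thin (Γ : SimpleGraph V) : Prop :=
  ∀ a b x y, Γ.Adj a b → InStar Γ a x → InStar Γ b y →
    ∃ z, (z = a ∨ z = b) ∧ Γ.dist x z + Γ.dist z y ≤ Γ.dist x y

/-- Thinness puts a vertex `z` of both stars on a geodesic from `x` to `y`, and the two letters can
be served at `z` in either order. -/
theorem Traverses.swap (hΓ : Γ.Connected) (hT : Thin Γ) {u v a b : V} {l : List V} {n : ℕ}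
    (hab : Γ.Adj a b) (h : Traverses Γ u (a :: b :: l) v n) :
    Traverses Γ u (b :: a :: l) v n := by
  obtain ⟨x, p, hx, hp, y, q, hy, hq, h⟩ := h
  obtain ⟨z, hz, hd⟩ := hT a b x y hab hx hy
  have hza : InStar Γ a z := by
    rcases hz with rfl | rfl
    exacts [.refl _, Or.inr hab]
  have hzb : InStar Γ b z := by
    rcases hz with rfl | rfl
    exacts [Or.inr hab.symm, .refl _]
  refine ⟨z, Γ.dist z y + q, hzb, ?_, z, _, hza, by simp, h.prepend hΓ⟩
  have := hΓ.dist_triangle (u := u) (v := x) (w := z)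
  omega

/-- `Traverses`, for the vertices of a word. -/
abbrev TraversesWord (Γ : SimpleGraph V) (u : V) (w : List (V × Bool)) (v : V) (n : ℕ) : Prop :=
  Traverses Γ u (w.map Prod.fst) v n

theorem SwapEquiv.traverses (hΓ : Γ.Connected) (hT : Thin Γ) {w w' : List (V × Bool)}
    (h : SwapEquiv Γ w w') {u v : V} {n : ℕ} (ht : TraversesWord Γ u w v n) :
    TraversesWord Γ u w' v n := by
  induction h generalizing u n with
  | refl w => exact ht
  | cons x _ ih =>
    obtain ⟨y, p, hy, hp, ht⟩ := ht
    exact ⟨y, p, hy, hp, ih ht⟩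
  | swap w h => exact Traverses.swap hΓ hT h ht
  | trans _ _ ih₁ ih₂ => exact ih₂ (ih₁ ht)

/-- Reduction uses only swaps and deletions, neither of which raises the cost, and it leads to `r`
up to swaps. -/
theorem Reduced.traverses (hΓ : Γ.Connected) (hT : Thin Γ) {w r : List (V × Bool)}
    (hr : Reduced Γ r) (h : wordVal Γ w = wordVal Γ r) {u v : V} {n : ℕ}
    (ht : TraversesWord Γ u w v n) : TraversesWord Γ u r v n := by
  obtain ⟨r', hr', hv, hR, -⟩ := exists_reduced (Γ := Γ)
    (fun w w' => ∀ u n, TraversesWord Γ u w v n → TraversesWord Γ u w' v n)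
    (fun w w' h u n ht => h.traverses hΓ hT ht)
    (fun x w w' h u n ⟨y, p, hy, hp, ht⟩ => ⟨y, p, hy, hp, h _ _ ht⟩)
    (fun x w u n ht => Traverses.of_cons hΓ ht) (fun _ _ _ h h' u n ht => h' _ _ (h _ _ ht)) w
  exact (hr'.swapEquiv hr (hv.trans h)).traverses hΓ hT (hR _ _ ht)

/-! ### The distance of the extension graph in terms of traversals -/

theorem ExtVertex.conj_conj (x : ExtVertex Γ) (a b : RAAG Γ) :
    (x.conj a).conj b = x.conj (a * b) :=
  Subtype.ext (by simp [ExtVertex.conj, mul_assoc])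

theorem ExtVertex.conj_one (x : ExtVertex Γ) : x.conj 1 = x :=
  Subtype.ext (by simp [ExtVertex.conj])

theorem conj_eq_of_commute {v : V} {g : RAAG Γ} (h : Commute (gen Γ v) g) :
    (baseVertex Γ v).conj g = baseVertex Γ v :=
  Subtype.ext (by simp [ExtVertex.conj, baseVertex, mul_assoc, h.eq])

theorem ExtVertex.exists_eq_conj (x : ExtVertex Γ) :
    ∃ v g, x = (baseVertex Γ v).conj g := by
  obtain ⟨v, g, hx⟩ := x.2
  exact ⟨v, g, Subtype.ext hx⟩

/-- Conjugation as an endomorphism of the extension graph. -/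
def conjHom (g : RAAG Γ) : extensionGraph Γ →g extensionGraph Γ where
  toFun x := x.conj g
  map_rel' := by
    rintro a b ⟨hab, hc⟩
    refine ⟨fun h => hab (Subtype.ext ?_), ?_⟩
    · have := congrArg Subtype.val h
      simpa [ExtVertex.conj] using this
    · have := hc.map (MulAut.conj g⁻¹)
      simpa [ExtVertex.conj] using this

/-- The graph as a subgraph of its extension graph. -/
def baseHom (Γ : SimpleGraph V) : Γ →g extensionGraph Γ where
  toFun := baseVertex Γ
  map_rel' hab := ⟨fun h => hab.ne (gen_injective Γ (congrArg Subtype.val h)), gen_commute hab⟩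

theorem dist_map_le {W W' : Type*} {G : SimpleGraph W} {G' : SimpleGraph W'} (hG : G.Connected)
    (f : G →g G') (x y : W) : G'.dist (f x) (f y) ≤ G.dist x y := by
  obtain ⟨p, hp⟩ := hG.exists_walk_length_eq_dist x y
  rw [← hp, ← SimpleGraph.Walk.length_map f]
  exact SimpleGraph.dist_le _

theorem dist_conj (hΓ : Γ.Connected) (g : RAAG Γ) (x y : ExtVertex Γ) :
    (extensionGraph Γ).dist (x.conj g) (y.conj g) = (extensionGraph Γ).dist x y := by
  have h := extensionGraph_connected hΓ
  refine le_antisymm (dist_map_le h (conjHom g) x y) ?_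
  have := dist_map_le h (conjHom g⁻¹) (x.conj g) (y.conj g)
  simpa [conjHom, ExtVertex.conj_conj, ExtVertex.conj_one] using this

theorem dist_le_of_traverses (hΓ : Γ.Connected) {u v : V} {w : List (V × Bool)} {n : ℕ}
    (h : TraversesWord Γ v w u n) :
    (extensionGraph Γ).dist (baseVertex Γ u) ((baseVertex Γ v).conj (wordVal Γ w)) ≤ n := by
  have hE := extensionGraph_connected hΓ
  induction w generalizing v n with
  | nil =>
    rw [wordVal_nil, ExtVertex.conj_one, SimpleGraph.dist_comm]
    exact (dist_map_le hΓ (baseHom Γ) v u).trans h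
  | cons a w ih =>
    obtain ⟨x, p, hx, hp, h⟩ := h
    have h1 := ih h
    -- The generator at `x` commutes with the letter `a`, which therefore drops out of the
    -- conjugator.
    have h2 : (baseVertex Γ x).conj (wordVal Γ (a :: w)) =
        (baseVertex Γ x).conj (wordVal Γ w) := by
      rw [wordVal_cons, ← ExtVertex.conj_conj, conj_eq_of_commute]
      exact letter_commute_of_inStar (x := (x, true)) hx.symm
    have h3 := dist_conj hΓ (wordVal Γ (a :: w)) (baseVertex Γ x) (baseVertex Γ v)
    have h4 : (extensionGraph Γ).dist (baseVertex Γ x) (baseVertex Γ v) ≤ Γ.dist v x := by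
      rw [SimpleGraph.dist_comm]
      exact dist_map_le hΓ (baseHom Γ) v x
    rw [h2] at h3
    have h5 := hE.dist_triangle (u := baseVertex Γ u) (v := (baseVertex Γ x).conj (wordVal Γ w))
      (w := (baseVertex Γ v).conj (wordVal Γ (a :: w)))
    omega

theorem traversesWord_of_commute {v : V} {g : RAAG Γ} (h : Commute (gen Γ v) g) :
    ∃ w, wordVal Γ w = g ∧ TraversesWord Γ v w v 0 := by
  obtain ⟨w, hw, hs⟩ := exists_star_word_of_commute h
  refine ⟨w, hw, traverses_of_inStar fun a ha => ?_⟩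
  obtain ⟨x, hx, rfl⟩ := List.mem_map.1 ha
  exact hs x hx

/-- Each edge of the path becomes one step `v`, `v'` in `Γ`; the conjugator changes by an element of
the centralizer of `v`, whose star word is traversed while standing at `v`. -/
theorem exists_traverses_of_walk (hΓ : Γ.Connected) {x y : ExtVertex Γ}
    (p : (extensionGraph Γ).Walk x y) {u v : V} {g : RAAG Γ} (hy : y = baseVertex Γ u)
    (hx : x = (baseVertex Γ v).conj g) :
    ∃ w, wordVal Γ w = g ∧ TraversesWord Γ v w u p.length := by
  induction p generalizing v g with
  | nil =>
    subst hy
    have h1 : gen Γ u = g⁻¹ * gen Γ v * g := congrArg Subtype.val hx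
    -- The free abelian quotient separates conjugates of different generators.
    have h2 : u = v := by
      let φ : RAAG Γ →* Multiplicative (V →₀ ℤ) :=
        PresentedGroup.toGroup (f := fun v => Multiplicative.ofAdd (Finsupp.single v 1)) (by
          rintro r ⟨u, v, -, rfl⟩
          rw [map_commutatorElement, commutatorElement_eq_one_iff_commute]
          exact Commute.all _ _)
      have hφ : ∀ v, φ (gen Γ v) = Multiplicative.ofAdd (Finsupp.single v 1) :=
        fun v => PresentedGroup.toGroup.of _
      have h3 := congrArg φ h1
      rw [map_mul, map_mul, map_inv, mul_comm, mul_inv_cancel_left, hφ, hφ] at h3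
      exact Finsupp.single_left_injective one_ne_zero (Multiplicative.ofAdd.injective h3)
    subst h2
    refine traversesWord_of_commute (g := g) ?_
    change gen Γ u * g = g * gen Γ u
    conv_rhs => rw [h1]
    group
  | @cons x x' y hadj p ih =>
    subst hx
    obtain ⟨v', g', rfl⟩ := x'.exists_eq_conj
    have hadj' := (conjHom g⁻¹).map_adj hadj
    simp only [conjHom, RelHom.coeFn_mk, ExtVertex.conj_conj, mul_inv_cancel,
      ExtVertex.conj_one] at hadj'
    obtain ⟨hvv, s', s, hs', hs, hc⟩ := adj_and_commute_of_adj (Γ := Γ) (v := v) (v' := v')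
      (c := g' * g⁻¹) (fun h => hadj'.1 (Subtype.ext h)) hadj'.2
    obtain ⟨w₁, hw₁, ht₁⟩ := ih (v := v') (g := s * g) hy (by
      have : g' = s' * (s * g) := by rw [← mul_assoc, ← hc]; simp
      rw [this, ← ExtVertex.conj_conj, conj_eq_of_commute hs'])
    obtain ⟨w₀, hw₀, ht₀⟩ := traversesWord_of_commute hs.inv_right
    refine ⟨w₀ ++ w₁, by simp [hw₀, hw₁], ?_⟩
    have h1 := Traverses.append hΓ ht₀ (ht₁.prepend hΓ)
    rw [← List.map_append] at h1
    refine h1.mono ?_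
    rw [SimpleGraph.dist_eq_one_iff_adj.2 hvv, SimpleGraph.Walk.length_cons]
    omega

theorem dist_le_iff_traverses (hΓ : Γ.Connected) (hT : Thin Γ) {u v : V} {r : List (V × Bool)}
    (hr : Reduced Γ r) {n : ℕ} :
    (extensionGraph Γ).dist (baseVertex Γ u) ((baseVertex Γ v).conj (wordVal Γ r)) ≤ n ↔
      TraversesWord Γ v r u n := by
  refine ⟨fun h => ?_, dist_le_of_traverses hΓ⟩
  obtain ⟨p, hp⟩ := (extensionGraph_connected hΓ).exists_walk_length_eq_dist
    ((baseVertex Γ v).conj (wordVal Γ r)) (baseVertex Γ u)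
  obtain ⟨w, hw, ht⟩ := exists_traverses_of_walk hΓ p rfl rfl
  rw [SimpleGraph.dist_comm] at hp
  exact (hr.traverses hΓ hT hw ht).mono (hp.trans_le h)

/-! ### Translation lengths from bounds on even powers -/

/-- A bound on the even powers at one vertex determines the translation length. -/
theorem hasTranslationLength_of_bounds (hΓ : Γ.Connected) {g : RAAG Γ} {x₀ : ExtVertex Γ}
    (T C : ℕ) (hU : ∀ m : ℕ, (extensionGraph Γ).dist x₀ (x₀.conj (g ^ (2 * m))) ≤ m * T + C)
    (hL : ∀ m : ℕ, m * T ≤ (extensionGraph Γ).dist x₀ (x₀.conj (g ^ (2 * m))) + C) :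
    HasTranslationLength Γ g ((T : ℝ) / 2) := by
  have hE := extensionGraph_connected hΓ
  intro x
  set d := (extensionGraph Γ).dist
  have htri : ∀ a b c, d a c ≤ d a b + d b c := fun a b c => hE.dist_triangle
  have hcomm : ∀ a b, d a b = d b a := fun a b => SimpleGraph.dist_comm
  have hconj : ∀ h a b, d (a.conj h) (b.conj h) = d a b := dist_conj hΓ
  obtain ⟨D, hD⟩ : ∃ D : ℕ, ∀ n : ℕ, 2 * d x (x.conj (g ^ n)) ≤ n * T + D ∧
      n * T ≤ 2 * d x (x.conj (g ^ n)) + D := by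
    -- Everything is doubled: moving the base point costs `d x x₀` at both ends, and an odd exponent
    -- costs one more translate of `x₀` and one more `T`.
    refine ⟨2 * C + 4 * d x x₀ + 2 * d x₀ (x₀.conj g) + T, fun n => ?_⟩
    have h1 := htri x x₀ (x.conj (g ^ n))
    have h2 := htri x₀ (x₀.conj (g ^ n)) (x.conj (g ^ n))
    have h3 := htri x₀ x (x₀.conj (g ^ n))
    have h4 := htri x (x.conj (g ^ n)) (x₀.conj (g ^ n))
    rw [hconj] at h2 h4
    rw [hcomm x₀ x] at h2 h3
    rcases Nat.even_or_odd' n with ⟨m, rfl | rfl⟩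
    · have hu := hU m
      have hl := hL m
      have e : 2 * m * T = 2 * (m * T) := by ring
      change d _ _ ≤ _ at hu
      change _ ≤ d _ _ + _ at hl
      rw [e]
      constructor <;> omega
    · have hu := hU m
      have hl := hL m
      change d _ _ ≤ _ at hu
      change _ ≤ d _ _ + _ at hl
      have e : (2 * m + 1) * T = 2 * (m * T) + T := by ring
      have h5 := hconj (g ^ (2 * m)) x₀ (x₀.conj g)
      rw [ExtVertex.conj_conj, ← pow_succ'] at h5
      have h6 := htri x₀ (x₀.conj (g ^ (2 * m))) (x₀.conj (g ^ (2 * m + 1)))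
      have h7 := htri x₀ (x₀.conj (g ^ (2 * m + 1))) (x₀.conj (g ^ (2 * m)))
      rw [hcomm (x₀.conj (g ^ (2 * m + 1)))] at h7
      rw [e]
      constructor <;> omega
  have hlim : Tendsto (fun n : ℕ => (D : ℝ) / 2 / n) atTop (𝓝 0) :=
    tendsto_const_div_atTop_nhds_zero_nat _
  rw [tendsto_iff_dist_tendsto_zero]
  refine squeeze_zero' (Eventually.of_forall fun n => dist_nonneg) ?_ hlim
  filter_upwards [eventually_gt_atTop 0] with n hn
  obtain ⟨h1, h2⟩ := hD n
  have hn' : (0 : ℝ) < n := by exact_mod_cast hn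
  have h1' : (2 : ℝ) * d x (x.conj (g ^ n)) ≤ n * T + D := by exact_mod_cast h1
  have h2' : (n : ℝ) * T ≤ 2 * d x (x.conj (g ^ n)) + D := by exact_mod_cast h2
  have e : (d x (x.conj (g ^ n)) : ℝ) / n - T / 2 =
      ((d x (x.conj (g ^ n)) : ℝ) - n * T / 2) / n := by field_simp
  rw [Real.dist_eq, e, abs_div, abs_of_pos hn']
  gcongr
  rw [abs_le]
  constructor <;> linarith

theorem hasTranslationLength_conj (hΓ : Γ.Connected) {g : RAAG Γ} {t : ℝ} (h : RAAG Γ)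
    (ht : HasTranslationLength Γ (h * g * h⁻¹) t) : HasTranslationLength Γ g t := by
  intro x
  have := ht (x.conj h⁻¹)
  refine this.congr fun n => ?_
  congr 2
  rw [← dist_conj hΓ h, conj_pow, ExtVertex.conj_conj, ExtVertex.conj_conj, ExtVertex.conj_conj]
  simp [ExtVertex.conj_one, mul_assoc]

theorem exists_traverses (u v : V) (l : List V) :
    ∃ n, Traverses Γ u l v n := by
  induction l generalizing u with
  | nil => exact ⟨_, le_rfl⟩
  | cons a l ih =>
    obtain ⟨n, hn⟩ := ih a
    exact ⟨_, a, n, .refl a, le_rfl, hn⟩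

/-! ### Degree at most two: optimal traversals move between two states -/

/-- Every vertex has at most two neighbours. -/
def DegreeLETwo (Γ : SimpleGraph V) : Prop := ∀ a, ∃ a₁ a₂, ∀ x, Γ.Adj a x → x = a₁ ∨ x = a₂

theorem exists_adj_dist_add_one (hΓ : Γ.Connected) {x a : V} (h : x ≠ a) :
    ∃ s, Γ.Adj a s ∧ Γ.dist x s + 1 ≤ Γ.dist x a := by
  obtain ⟨p, hp⟩ := hΓ.exists_walk_length_eq_dist a x
  cases p with
  | nil => exact absurd rfl h
  | @cons _ s _ has p =>
    refine ⟨s, has, ?_⟩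
    rw [SimpleGraph.dist_comm (u := x) (v := a), ← hp, SimpleGraph.dist_comm,
      SimpleGraph.Walk.length_cons]
    exact Nat.succ_le_succ (SimpleGraph.dist_le p)

/-- The geodesics from the star of `b` to the star of `a` may be assumed to enter it in one of two
vertices. -/
theorem exists_two_entries (hΓ : Γ.Connected) (hT : Thin Γ) (hdeg : DegreeLETwo Γ) {a b : V}
    (hab : a ≠ b) : ∃ s₁ s₂, ∀ x y, InStar Γ b x → InStar Γ a y →
      ∃ s, (s = s₁ ∨ s = s₂) ∧ InStar Γ a s ∧ Γ.dist x s + Γ.dist s y ≤ Γ.dist x y := by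
  by_cases hadj : Γ.Adj b a
  · refine ⟨b, a, fun x y hx hy => ?_⟩
    obtain ⟨z, hz, hd⟩ := hT b a x y hadj hx hy
    refine ⟨z, hz, ?_, hd⟩
    rcases hz with rfl | rfl
    exacts [Or.inr hadj.symm, .refl _]
  · obtain ⟨a₁, a₂, ha⟩ := hdeg a
    refine ⟨a₁, a₂, fun x y hx hy => ?_⟩
    rcases hy with rfl | hy
    · have hxy : x ≠ y := by
        rintro rfl
        exact hx.elim hab hadj
      obtain ⟨s, hs, hd⟩ := exists_adj_dist_add_one hΓ hxy
      refine ⟨s, ha s hs, Or.inr hs, ?_⟩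
      rwa [SimpleGraph.dist_comm (u := s), SimpleGraph.dist_eq_one_iff_adj.2 hs]
    · exact ⟨y, ha y hy, Or.inr hy, by simp⟩

/-- Traversals of `l` may be assumed to end in `s₁` or `s₂`, and to go straight on from there. -/
def EndsIn (Γ : SimpleGraph V) (l : List V) (s₁ s₂ : V) : Prop :=
  ∀ u v n, Traverses Γ u l v n →
    ∃ s p, (s = s₁ ∨ s = s₂) ∧ Traverses Γ u l s p ∧ p + Γ.dist s v ≤ n

/-- The letter `b ≠ a` before the last ensures that the walk comes from the star of `b`, so it can
be made to enter the star of `a` at one of two vertices and finish the word there. -/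
theorem exists_endsIn (hΓ : Γ.Connected) (hT : Thin Γ) (hdeg : DegreeLETwo Γ) {a b : V}
    (hab : a ≠ b) (l : List V) : ∃ s₁ s₂, EndsIn Γ (l ++ [b, a]) s₁ s₂ := by
  obtain ⟨s₁, s₂, hs⟩ := exists_two_entries hΓ hT hdeg hab
  refine ⟨s₁, s₂, fun u v n h => ?_⟩
  obtain ⟨z, p, q, h₁, ⟨x, q₁, hx, hq₁, y, q₂, hy, hq₂, h₂⟩, hpq⟩ := (traverses_append hΓ).1 h
  obtain ⟨s, hs, hsa, hd⟩ := hs x y hx hy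
  refine ⟨s, p + (Γ.dist z x + Γ.dist x s), hs,
    h₁.append hΓ ⟨x, Γ.dist x s, hx, le_rfl, s, 0, hsa, by simp, by simp [Traverses]⟩, ?_⟩
  have h₃ : Γ.dist y v ≤ q₂ := h₂
  have := hΓ.dist_triangle (u := s) (v := y) (w := v)
  omega

theorem EndsIn.split (hΓ : Γ.Connected) {l l' : List V} {s₁ s₂ : V} (hl : EndsIn Γ l s₁ s₂)
    {u v : V} {n : ℕ} (h : Traverses Γ u (l ++ l') v n) :
    ∃ s p q, (s = s₁ ∨ s = s₂) ∧ Traverses Γ u l s p ∧ Traverses Γ s l' v q ∧ p + q ≤ n := by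
  obtain ⟨x, p, q, h₁, h₂, hpq⟩ := (traverses_append hΓ).1 h
  obtain ⟨s, p', hs, h₁', hd⟩ := hl _ _ _ h₁
  exact ⟨s, p', _, hs, h₁', h₂.prepend hΓ, by omega⟩

theorem Traverses.pow (hΓ : Γ.Connected) {s : V} {l : List V} {T : ℕ}
    (h : Traverses Γ s (l ++ l) s T) (m : ℕ) :
    Traverses Γ s (List.replicate (2 * m) l).flatten s (m * T) := by
  induction m with
  | zero => simp [Traverses]
  | succ m ih =>
    have := h.append hΓ ih
    rw [show 2 * (m + 1) = 2 * m + 1 + 1 by ring, List.replicate_succ, List.replicate_succ,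
      List.flatten_cons, List.flatten_cons, ← List.append_assoc]
    exact this.mono (by ring_nf; rfl)

/-- Among three consecutive states two agree, so a loop over one or two copies of `l` can be cut
out. A loop over one copy, run twice, costs at least `T`; a loop over two copies costs at least `T`
directly. The additive `T` pays for a last unpaired copy. -/
theorem EndsIn.lower_bound (hΓ : Γ.Connected) {l : List V} {s₁ s₂ : V} (hl : EndsIn Γ l s₁ s₂)
    {T : ℕ} (hT : ∀ s n, (s = s₁ ∨ s = s₂) → Traverses Γ s (l ++ l) s n → T ≤ n) (n : ℕ) :
    ∀ (s v : V) (N : ℕ), (s = s₁ ∨ s = s₂) →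
      Traverses Γ s (List.replicate n l).flatten v N → n * T ≤ 2 * N + T := by
  induction n using Nat.strong_induction_on with
  | _ n ih =>
    intro s v N hs h
    match n with
    | 0 => omega
    | 1 => omega
    | n + 2 =>
      rw [List.replicate_succ, List.flatten_cons] at h
      obtain ⟨x, p, q, hx, h₁, h₂, hpq⟩ := hl.split hΓ h
      have e1 : (n + 2) * T = (n + 1) * T + T := by ring
      by_cases hsx : x = s
      · subst hsx
        have := hT _ _ hs (h₁.append hΓ h₁)
        have := ih (n + 1) (by omega) x v q hx h₂
        omega
      rw [List.replicate_succ, List.flatten_cons] at h₂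
      obtain ⟨y, p', q', hy, h₃, h₄, hpq'⟩ := hl.split hΓ h₂
      -- After `s ≠ x`, the state `y` equals `x` (cut the one-copy loop at `x`) or `s` (cut the
      -- two-copy loop at `s`).
      have e2 : (n + 1) * T = n * T + T := by ring
      by_cases hxy : y = x
      · subst hxy
        have h5 := hT _ _ hy (h₃.append hΓ h₃)
        have h6 := h₁.append hΓ h₄
        rw [← List.flatten_cons, ← List.replicate_succ] at h6
        have := ih (n + 1) (by omega) s v _ hs h6
        omega
      · have hys : y = s := by
          rcases hs with rfl | rfl <;> rcases hx with rfl | rfl <;> rcases hy with rfl | rfl <;>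
            first | rfl | exact absurd rfl hsx | exact absurd rfl hxy
        subst hys
        have h5 := hT _ _ hs (h₁.append hΓ h₃)
        have := ih n (by omega) y v q' hy h₄
        omega

/-- A colouring that computes the parity of the distances. -/
def ParityColoring (Γ : SimpleGraph V) (c : V → ℕ) : Prop := ∀ u v, Even (Γ.dist u v + c u + c v)

theorem Traverses.exists_even {c : V → ℕ} (hc : ParityColoring Γ c) {u v : V} {l : List V} {n : ℕ}
    (h : Traverses Γ u l v n) : ∃ n' ≤ n, Traverses Γ u l v n' ∧ Even (n' + c u + c v) := by
  induction l generalizing u n with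
  | nil => exact ⟨_, h, le_rfl, hc u v⟩
  | cons a l ih =>
    obtain ⟨x, p, hx, hp, h⟩ := h
    obtain ⟨p', hp', h', he⟩ := ih h
    refine ⟨Γ.dist u x + p', by omega, ⟨x, p', hx, le_rfl, h'⟩, ?_⟩
    have := hc u x
    rw [Nat.even_iff] at *
    omega

theorem hasTranslationLength_zero_of_commute (hΓ : Γ.Connected) {g : RAAG Γ} {v : V}
    (h : Commute (gen Γ v) g) : HasTranslationLength Γ g (((0 : ℕ) : ℝ) / 2) := by
  have h' : ∀ n : ℕ, (baseVertex Γ v).conj (g ^ n) = baseVertex Γ v :=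
    fun n => conj_eq_of_commute (h.pow_right n)
  refine hasTranslationLength_of_bounds hΓ (x₀ := baseVertex Γ v) 0 0 ?_ ?_ <;> simp [h']

theorem map_flatten_replicate {α β : Type*} (f : α → β) (l : List α) (n : ℕ) :
    (List.replicate n l).flatten.map f = (List.replicate n (l.map f)).flatten := by
  simp [List.map_flatten]

/-- In a graph of degree at most two with thin stars, the translation lengths are half-integers,
and integers if the graph is bipartite. -/
theorem exists_translationLength (hΓ : Γ.Connected) (hT : Thin Γ) (hdeg : DegreeLETwo Γ)
    (g : RAAG Γ) : ∃ T : ℕ, HasTranslationLength Γ g ((T : ℝ) / 2) ∧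
      ∀ c, ParityColoring Γ c → Even T := by
  classical
  obtain ⟨h, w, hw, hmin⟩ := exists_cyclicallyMinimal g
  by_cases hlab : w.IsChain fun x y => x.1 = y.1
  · obtain ⟨v, hv⟩ : ∃ v, ∀ x ∈ w, x.1 = v := by
      cases w with
      | nil => exact ⟨hΓ.nonempty.some, by simp⟩
      | cons x w =>
        refine ⟨x.1, fun y hy => ?_⟩
        have : (x :: w).Pairwise fun x y => x.1 = y.1 :=
          (List.isChain_iff_pairwise (R := fun x y : V × Bool => x.1 = y.1)).1 hlab
        rcases List.mem_cons.1 hy with rfl | hy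
        · rfl
        · exact ((List.pairwise_cons.1 this).1 y hy).symm
    refine ⟨0, hasTranslationLength_conj hΓ h ?_, fun _ _ => Even.zero⟩
    rw [← hw]
    exact hasTranslationLength_zero_of_commute hΓ (commute_wordVal fun x hx => Or.inl (hv x hx))
  rw [List.isChain_iff_forall_rel_of_append_cons_cons] at hlab
  push Not at hlab
  obtain ⟨y, x, l₁, l₂, rfl, hyx⟩ := hlab
  -- Rotation is a conjugation; it puts two letters at different vertices last, as `exists_endsIn`
  -- requires.
  set w' := l₂ ++ (l₁ ++ [y, x]) with hw'
  have hmin' : CyclicallyMinimal Γ w' :=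
    CyclicallyMinimal.rotate (by simpa using hmin)
  have hg : wordVal Γ w' = (wordVal Γ l₂ * h) * g * (wordVal Γ l₂ * h)⁻¹ := by
    have e : wordVal Γ w' = wordVal Γ l₂ * wordVal Γ (l₁ ++ y :: x :: l₂) * (wordVal Γ l₂)⁻¹ := by
      simp [hw', mul_assoc]
    rw [e, hw]
    group
  obtain ⟨s₁, s₂, hs⟩ := exists_endsIn hΓ hT hdeg (a := x.1) (b := y.1) hyx.symm
    ((l₂ ++ l₁).map Prod.fst)
  have hl : (l₂ ++ l₁).map Prod.fst ++ [y.1, x.1] = w'.map Prod.fst := by simp [hw']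
  rw [hl] at hs
  set l := w'.map Prod.fst
  have hex : ∃ n s, (s = s₁ ∨ s = s₂) ∧ Traverses Γ s (l ++ l) s n := by
    obtain ⟨n, hn⟩ := exists_traverses (Γ := Γ) s₁ s₁ (l ++ l)
    exact ⟨n, s₁, Or.inl rfl, hn⟩
  obtain ⟨s, hs', ht⟩ := Nat.find_spec hex
  have hm : ∀ s n, (s = s₁ ∨ s = s₂) → Traverses Γ s (l ++ l) s n → Nat.find hex ≤ n :=
    fun s n h1 h2 => Nat.find_min' hex ⟨s, h1, h2⟩
  refine ⟨Nat.find hex, hasTranslationLength_conj hΓ (wordVal Γ l₂ * h) ?_, fun c hc => ?_⟩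
  · rw [← hg]
    have key : ∀ m n, (extensionGraph Γ).dist (baseVertex Γ s)
        ((baseVertex Γ s).conj (wordVal Γ w' ^ (2 * m))) ≤ n ↔
        Traverses Γ s (List.replicate (2 * m) l).flatten s n := by
      intro m n
      rw [← wordVal_replicate, dist_le_iff_traverses hΓ hT (hmin'.reduced_pow _),
        TraversesWord, map_flatten_replicate]
    refine hasTranslationLength_of_bounds hΓ (x₀ := baseVertex Γ s) _ (Nat.find hex)
      (fun m => ?_) (fun m => ?_)
    · exact ((key m _).2 (ht.pow hΓ m)).trans (Nat.le_add_right _ _)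
    · have := hs.lower_bound hΓ hm (2 * m) s s _ hs' ((key m _).1 le_rfl)
      rw [mul_assoc] at this
      omega
  -- Discarding slack leaves a closed walk, of even length by the colouring; minimality makes this
  -- length `T`.
  · obtain ⟨n', hn', ht', he⟩ := ht.exists_even hc
    have := hm s n' hs' ht'
    rw [Nat.even_iff] at *
    omega

/-! ### The metric of a cycle -/

/-- The distance of two residues on a cycle of length `k`. -/
def cycleDist (k i j : ℕ) : ℕ := min (i - j + (j - i)) (k - (i - j + (j - i)))

section Cycle

variable {k : ℕ}

theorem fin_sub_val (u v : Fin k) : ((u - v).val = u.val - v.val ∧ v.val ≤ u.val) ∨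
    ((u - v).val = k + u.val - v.val ∧ u.val < v.val) := by
  rcases le_or_gt v u with h | h
  · exact Or.inl ⟨Fin.coe_sub_iff_le.2 h, h⟩
  · exact Or.inr ⟨Fin.coe_sub_iff_lt.2 h, h⟩

theorem cycleGraph_adj_val (hk : 3 ≤ k) {u v : Fin k} : (SimpleGraph.cycleGraph k).Adj u v ↔
    u.val + 1 = v.val ∨ v.val + 1 = u.val ∨ (u.val = 0 ∧ v.val + 1 = k) ∨
      (v.val = 0 ∧ u.val + 1 = k) := by
  have hu := u.2
  have hv := v.2
  rw [SimpleGraph.cycleGraph_adj']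
  have h1 := fin_sub_val u v
  have h2 := fin_sub_val v u
  omega

theorem cycleGraph_connected_of_pos (hk : 0 < k) : (SimpleGraph.cycleGraph k).Connected := by
  obtain ⟨n, rfl⟩ := Nat.exists_eq_succ_of_ne_zero hk.ne'
  exact SimpleGraph.cycleGraph_connected

theorem cycleDist_le_length (hk : 3 ≤ k) {u v : Fin k}
    (p : (SimpleGraph.cycleGraph k).Walk u v) : cycleDist k u v ≤ p.length := by
  induction p with
  | nil => simp [cycleDist]
  | @cons a b c h p ih =>
    rw [cycleGraph_adj_val hk] at h
    rw [SimpleGraph.Walk.length_cons]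
    unfold cycleDist at *
    have := a.2
    have := b.2
    have := c.2
    omega

theorem exists_adj_cycleDist (hk : 3 ≤ k) {u v : Fin k} (h : u ≠ v) :
    ∃ u', (SimpleGraph.cycleGraph k).Adj u u' ∧ cycleDist k u' v + 1 ≤ cycleDist k u v := by
  have hu := u.2
  have hv := v.2
  have huv : u.val ≠ v.val := fun h' => h (Fin.ext h')
  suffices ∃ i, ∃ hi : i < k, (SimpleGraph.cycleGraph k).Adj u ⟨i, hi⟩ ∧
      cycleDist k i v + 1 ≤ cycleDist k u v by
    obtain ⟨i, hi, h⟩ := this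
    exact ⟨⟨i, hi⟩, h⟩
  simp only [cycleGraph_adj_val hk]
  unfold cycleDist
  by_cases h1 : (u.val < v.val ∧ v.val - u.val ≤ k - (v.val - u.val)) ∨
      (v.val < u.val ∧ k - (u.val - v.val) < u.val - v.val)
  · by_cases h2 : u.val + 1 = k
    · exact ⟨0, by omega, by omega, by omega⟩
    · exact ⟨u + 1, by omega, by omega, by omega⟩
  · by_cases h2 : u.val = 0
    · exact ⟨k - 1, by omega, by omega, by omega⟩
    · exact ⟨u - 1, by omega, by omega, by omega⟩

theorem cycleGraph_dist (hk : 3 ≤ k) (u v : Fin k) :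
    (SimpleGraph.cycleGraph k).dist u v = cycleDist k u v := by
  have hc := cycleGraph_connected_of_pos (k := k) (by omega)
  apply le_antisymm
  · suffices ∀ n (u : Fin k), cycleDist k u v ≤ n →
        (SimpleGraph.cycleGraph k).dist u v ≤ n from this _ u le_rfl
    intro n
    induction n with
    | zero =>
      intro u hu
      by_cases h : u = v
      · simp [h]
      · obtain ⟨u', -, h'⟩ := exists_adj_cycleDist hk h
        omega
    | succ n ih =>
      intro u hu
      by_cases h : u = v
      · simp [h]
      · obtain ⟨u', hadj, h'⟩ := exists_adj_cycleDist hk h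
        have h1 := ih u' (by omega)
        have h2 := hc.dist_triangle (u := u) (v := u') (w := v)
        rw [SimpleGraph.dist_eq_one_iff_adj.2 hadj] at h2
        omega
  · obtain ⟨p, hp⟩ := hc.exists_walk_length_eq_dist u v
    exact hp ▸ cycleDist_le_length hk p

theorem cycleGraph_inStar_val (hk : 3 ≤ k) {u v : Fin k} :
    InStar (SimpleGraph.cycleGraph k) u v ↔
    v.val = u.val ∨ u.val + 1 = v.val ∨ v.val + 1 = u.val ∨ (u.val = 0 ∧ v.val + 1 = k) ∨
      (v.val = 0 ∧ u.val + 1 = k) := by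
  rw [InStar, cycleGraph_adj_val hk, Fin.ext_iff]

/-- The only case in which neither end lies on the edge is that of the two outer neighbours of `a`
and `b`. They are at distance exactly 3 because `k ≥ 6`, so the arc through the edge is geodesic. -/
theorem cycleGraph_thin (hk : 6 ≤ k) : Thin (SimpleGraph.cycleGraph k) := by
  intro a b x y hab hx hy
  by_cases hxb : x = b
  · exact ⟨b, Or.inr rfl, by simp [hxb]⟩
  by_cases hya : y = a
  · exact ⟨a, Or.inl rfl, by simp [hya]⟩
  by_cases hxa : x = a
  · exact ⟨a, Or.inl rfl, by simp [hxa]⟩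
  by_cases hyb : y = b
  · exact ⟨b, Or.inr rfl, by simp [hyb]⟩
  refine ⟨a, Or.inl rfl, ?_⟩
  replace hx := hx.resolve_left hxa
  replace hy := hy.resolve_left hyb
  simp only [cycleGraph_dist (k := k) (by omega)]
  rw [cycleGraph_adj_val (by omega)] at hab hx hy
  rw [Fin.ext_iff] at hxb hya
  have := a.2
  have := b.2
  have := x.2
  have := y.2
  have h3 : cycleDist k x y = 3 := by
    unfold cycleDist
    rcases hab with h | h | h | h <;> omega
  have h1 : cycleDist k x a = 1 := by
    unfold cycleDist
    omega
  have h2 : cycleDist k a y = 2 := by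
    unfold cycleDist
    rcases hab with h | h | h | h <;> omega
  omega

theorem cycleGraph_degreeLETwo (hk : 6 ≤ k) : DegreeLETwo (SimpleGraph.cycleGraph k) := by
  intro a
  have ha := a.2
  simp only [cycleGraph_adj_val (k := k) (by omega), Fin.ext_iff]
  by_cases h1 : a.val = 0
  · exact ⟨⟨k - 1, by omega⟩, ⟨1, by omega⟩, fun x hx => by simp only; omega⟩
  · by_cases h2 : a.val + 1 = k
    · exact ⟨⟨k - 2, by omega⟩, ⟨0, by omega⟩, fun x hx => by simp only; omega⟩
    · exact ⟨⟨a - 1, by omega⟩, ⟨a + 1, by omega⟩, fun x hx => by simp only; omega⟩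

theorem cycleGraph_parityColoring (hk : 3 ≤ k) (he : Even k) :
    ParityColoring (SimpleGraph.cycleGraph k) Fin.val := by
  intro u v
  rw [cycleGraph_dist hk, cycleDist]
  rw [Nat.even_iff] at *
  have := u.2
  have := v.2
  omega

/-! ### The special element of an odd cycle -/

theorem some_false_notMem_stack {V : Type*} {Γ : SimpleGraph V} {w : List (V × Bool)}
    (h : ∀ x ∈ w, x.2 = true) (b : V) : some false ∉ stack Γ w b := by
  unfold stack
  rw [List.mem_filterMap]
  rintro ⟨x, hx, hf⟩
  have := h x hx
  split_ifs at hf <;> simp_all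

theorem reduced_of_positive {V : Type*} {Γ : SimpleGraph V} {w : List (V × Bool)}
    (h : ∀ x ∈ w, x.2 = true) : Reduced Γ w := by
  induction w with
  | nil => exact reduced_nil
  | cons x w ih =>
    have hw : ∀ x ∈ w, x.2 = true := fun y hy => h y (by simp [hy])
    refine reduced_cons (ih hw) fun hh => ?_
    rw [h x (by simp)] at hh
    exact some_false_notMem_stack hw _ (List.mem_of_head? hh)

/-- The vertices of residues `a, a + m, a + 2 m, …` of a cycle. -/
def progression (hk : 0 < k) (m a n : ℕ) : List (Fin k) :=
  (List.range n).map fun i => cycleVertex hk (a + i * m)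

theorem progression_succ (hk : 0 < k) (m a n : ℕ) :
    progression hk m a (n + 1) = cycleVertex hk a :: progression hk m (a + m) n := by
  simp only [progression, List.range_succ_eq_map, List.map_cons, List.map_map, zero_mul, add_zero]
  congr 2
  funext i
  simp only [Function.comp_apply, Nat.succ_eq_add_one]
  congr 1
  ring

theorem flatten_replicate_progression (hk : 0 < k) (m j : ℕ) :
    (List.replicate j (progression hk m 0 k)).flatten = progression hk m 0 (j * k) := by
  induction j with
  | zero => simp [progression]
  | succ j ih =>
    rw [List.replicate_succ', List.flatten_append, ih, add_mul, one_mul]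
    simp only [progression, List.range_add, List.map_append, List.map_map, List.flatten_cons,
      List.flatten_nil, List.append_nil]
    congr 2
    funext i
    simp only [Function.comp_apply, cycleVertex, Fin.mk.injEq]
    rw [show 0 + (j * k + i) * m = (0 + i * m) + k * (j * m) by ring, Nat.add_mul_mod_self_left]

theorem cycleVertex_add (hk : 0 < k) {m : ℕ} (hm : m < k) (a : ℕ) :
    (cycleVertex hk (a + m)).val = (cycleVertex hk a).val + m ∨
      (cycleVertex hk (a + m)).val + k = (cycleVertex hk a).val + m := by
  simp only [cycleVertex]
  have h1 := Nat.mod_lt a hk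
  rw [Nat.add_mod, Nat.mod_eq_of_lt hm]
  rcases lt_or_ge (a % k + m) k with h | h
  · exact Or.inl (Nat.mod_eq_of_lt h)
  · rw [Nat.mod_eq_sub_mod h, Nat.mod_eq_of_lt (by omega)]
    omega

/-- The index `i` is a potential, which may be 1 when `x` is the predecessor of the current letter.
A step from `x` to `y` satisfies `2 * dist ≥ k - 4 + i(x) - i(y)`. The cheapest step, from `a + 1`
to `a + m - 1`, has length `m - 2`, but it ends at a predecessor, from which the next step costs at
least `m - 1`. -/
theorem progression_lower_bound (hk : 0 < k) {m : ℕ} (hm : 3 ≤ m) (hkm : k = 2 * m + 1) (n : ℕ) :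
    ∀ (a : ℕ) (x v : Fin k) (i N : ℕ),
      InStar (SimpleGraph.cycleGraph k) (cycleVertex hk a) x →
      (i = 0 ∨ (i = 1 ∧ (x.val + 1 = (cycleVertex hk a).val ∨
        (x.val + 1 = k ∧ (cycleVertex hk a).val = 0)))) →
      Traverses (SimpleGraph.cycleGraph k) x (progression hk m (a + m) n) v N →
      n * (k - 4) + i ≤ 2 * N + 1 := by
  induction n with
  | zero => intros; omega
  | succ n ih =>
    intro a x v i N hx hi h
    rw [progression_succ] at h
    obtain ⟨y, p, hy, hp, h⟩ := h
    rw [cycleGraph_dist (by omega)] at hp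
    have hadd := cycleVertex_add hk (show m < k by omega) a
    have hx' := (cycleGraph_inStar_val (by omega)).1 hx
    have hy' := (cycleGraph_inStar_val (by omega)).1 hy
    have h0 := ih (a + m) y v 0 p hy (Or.inl rfl) h
    have e : (n + 1) * (k - 4) = n * (k - 4) + (k - 4) := by ring
    rw [e]
    have hxk := x.2
    have hyk := y.2
    have hak := (cycleVertex hk a).2
    have hbk := (cycleVertex hk (a + m)).2
    unfold cycleDist at hp
    by_cases hy1 : y.val + 1 = (cycleVertex hk (a + m)).val ∨
        (y.val + 1 = k ∧ (cycleVertex hk (a + m)).val = 0)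
    · have h1 := ih (a + m) y v 1 p hy (Or.inr ⟨rfl, hy1⟩) h
      omega
    · omega

/-- Go forward `m - 2` steps from `a + 1` to `a + m - 1`, then back `m - 1` steps to `a`, which is
`a + 2m + 1` modulo `k`. This repeats every two letters. -/
theorem progression_upper_bound (hk : 0 < k) {m : ℕ} (hm : 3 ≤ m) (hkm : k = 2 * m + 1) (n : ℕ) :
    ∀ a : ℕ, Traverses (SimpleGraph.cycleGraph k) (cycleVertex hk (a + 1))
      (progression hk m a (2 * n)) (cycleVertex hk (a + 2 * n * m + 1)) (n * (k - 4)) := by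
  induction n with
  | zero => intro a; simp [progression, Traverses]
  | succ n ih =>
    intro a
    rw [show 2 * (n + 1) = 2 * n + 1 + 1 by ring, progression_succ, progression_succ]
    have h := ih (a + m + m)
    have ha1 := cycleVertex_add hk (show 1 < k by omega) a
    have ham := cycleVertex_add hk (show m < k by omega) a
    have hamm := cycleVertex_add hk (show m < k by omega) (a + m)
    have hamm1 := cycleVertex_add hk (show 1 < k by omega) (a + m + m)
    have hap := cycleVertex_add hk (show m - 1 < k by omega) a
    have h1 := (cycleVertex hk a).2
    have h2 := (cycleVertex hk (a + m)).2
    have h3 := (cycleVertex hk (a + m + m)).2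
    have h4 := (cycleVertex hk (a + 1)).2
    have h5 := (cycleVertex hk (a + m + m + 1)).2
    have h6 := (cycleVertex hk (a + (m - 1))).2
    have e : (n + 1) * (k - 4) = n * (k - 4) + (k - 4) := by ring
    refine ⟨cycleVertex hk (a + 1), (n + 1) * (k - 4), ?_, ?_, cycleVertex hk (a + (m - 1)),
      (m - 1) + n * (k - 4), ?_, ?_, ?_⟩
    · rw [cycleGraph_inStar_val (by omega)]
      omega
    · simp
    · rw [cycleGraph_inStar_val (by omega)]
      omega
    · rw [cycleGraph_dist (by omega), cycleDist]
      omega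
    · rw [show a + (2 * n + 1 + 1) * m + 1 = a + m + m + 2 * n * m + 1 by ring]
      refine (h.prepend (cycleGraph_connected_of_pos hk)).mono ?_
      rw [cycleGraph_dist (by omega), cycleDist]
      omega

/-- The word `v_{kl} v_{(k-1)l} ⋯ v_{2l} v_l`. -/
def oddCycleWord (hk : 0 < k) : List (Fin k × Bool) :=
  (List.range k).map fun i => (cycleVertex hk ((k - i) * ((k + 1) / 2)), true)

theorem wordVal_oddCycleWord (hk : 0 < k) :
    wordVal (SimpleGraph.cycleGraph k) (oddCycleWord hk) = oddCycleElement hk := by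
  simp [wordVal, oddCycleWord, oddCycleElement, letter, Function.comp_def]

theorem map_fst_oddCycleWord (hk : 0 < k) {m : ℕ} (hkm : k = 2 * m + 1) :
    (oddCycleWord hk).map Prod.fst = progression hk m 0 k := by
  simp only [oddCycleWord, progression, List.map_map]
  refine List.map_congr_left fun i hi => ?_
  have hi' := List.mem_range.1 hi
  simp only [Function.comp_apply, cycleVertex, Fin.mk.injEq]
  have hl : (k + 1) / 2 = m + 1 := by omega
  obtain ⟨j, hj⟩ := Nat.exists_eq_add_of_lt hi'
  -- As `l = m + 1` is `-m` modulo `k`, the residue of `(k - i) l` is that of `i m`.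
  have e : (k - i) * ((k + 1) / 2) + k * i = 0 + i * m + k * (m + 1) := by
    rw [hl, show k - i = j + 1 by omega]
    have : k = i + j + 1 := by omega
    nlinarith
  rw [← Nat.add_mul_mod_self_left, e, Nat.add_mul_mod_self_left]

theorem oddCycleElement_translationLength (hk : 0 < k) {m : ℕ} (hm : 3 ≤ m)
    (hkm : k = 2 * m + 1) : HasTranslationLength (SimpleGraph.cycleGraph k) (oddCycleElement hk)
      (((k * (k - 4) : ℕ) : ℝ) / 2) := by
  have hΓ := cycleGraph_connected_of_pos hk
  have hT := cycleGraph_thin (k := k) (by omega)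
  have key : ∀ j n, (extensionGraph (SimpleGraph.cycleGraph k)).dist
      (baseVertex _ (cycleVertex hk 1))
      ((baseVertex _ (cycleVertex hk 1)).conj (oddCycleElement hk ^ (2 * j))) ≤ n ↔
      Traverses (SimpleGraph.cycleGraph k) (cycleVertex hk 1) (progression hk m 0 (2 * (j * k)))
        (cycleVertex hk 1) n := by
    intro j n
    rw [← wordVal_oddCycleWord, ← wordVal_replicate, dist_le_iff_traverses hΓ hT,
      TraversesWord, map_flatten_replicate, map_fst_oddCycleWord hk hkm,
      flatten_replicate_progression, mul_assoc]
    refine reduced_of_positive fun x hx => ?_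
    simp only [List.mem_flatten, List.mem_replicate, oddCycleWord] at hx
    obtain ⟨_, ⟨-, rfl⟩, hx⟩ := hx
    obtain ⟨i, -, rfl⟩ := List.mem_map.1 hx
    rfl
  refine hasTranslationLength_of_bounds hΓ (x₀ := baseVertex _ (cycleVertex hk 1)) _
    ((SimpleGraph.cycleGraph k).dist (cycleVertex hk (m + 1)) (cycleVertex hk 1) + 1)
    (fun j => ?_) (fun j => ?_)
  · refine le_trans ((key j (j * k * (k - 4))).2 ?_) (by rw [mul_assoc]; omega)
    have := progression_upper_bound hk hm hkm (j * k) 0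
    have e : cycleVertex hk (0 + 2 * (j * k) * m + 1) = cycleVertex hk 1 := by
      simp only [cycleVertex, Fin.mk.injEq]
      rw [show 0 + 2 * (j * k) * m + 1 = 1 + k * (2 * j * m) by ring, Nat.add_mul_mod_self_left]
    rwa [e] at this
  -- The lower bound starts in the star of the letter before the first one. That letter is `m + 1`,
  -- since `m + 1 + m = k`; the detour to it goes into the additive constant.
  · have h := ((key j _).1 le_rfl).prepend hΓ (u' := cycleVertex hk (m + 1))
    have e : ∀ n, progression hk m 0 n = progression hk m (m + 1 + m) n := by
      intro n
      refine List.map_congr_left fun i hi => ?_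
      simp only [cycleVertex, Fin.mk.injEq]
      rw [show m + 1 + m + i * m = 0 + i * m + k by omega, Nat.add_mod_right]
    rw [e] at h
    have := progression_lower_bound hk hm hkm _ (m + 1) _ _ 0 _ (.refl _) (Or.inl rfl) h
    rw [mul_assoc, mul_assoc] at this
    omega

end Cycle

end CycleSpectrum

theorem mainTheorem7 (k : ℕ) (hk : 6 ≤ k) :
    (Even k → ∀ g : CycleSpectrum.RAAG (SimpleGraph.cycleGraph k), ∃ n : ℤ,
      CycleSpectrum.HasTranslationLength (SimpleGraph.cycleGraph k) g (n : ℝ)) ∧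
    (Odd k →
      (∀ g : CycleSpectrum.RAAG (SimpleGraph.cycleGraph k), ∃ n : ℤ,
        CycleSpectrum.HasTranslationLength (SimpleGraph.cycleGraph k) g ((n : ℝ) / 2)) ∧
      CycleSpectrum.HasTranslationLength (SimpleGraph.cycleGraph k)
        (CycleSpectrum.oddCycleElement (lt_of_lt_of_le (by norm_num) hk : 0 < k))
        ((k : ℝ) * ((k : ℝ) - 4) / 2) ∧
      0 < (k : ℝ) * ((k : ℝ) - 4) / 2 ∧
      ∀ n : ℤ, (k : ℝ) * ((k : ℝ) - 4) / 2 ≠ (n : ℝ)) := by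
  have hΓ := CycleSpectrum.cycleGraph_connected_of_pos (k := k) (by omega)
  have hT := CycleSpectrum.cycleGraph_thin hk
  have hdeg := CycleSpectrum.cycleGraph_degreeLETwo hk
  have hk' : (6 : ℝ) ≤ k := by exact_mod_cast hk
  refine ⟨fun he g => ?_, fun ho => ⟨fun g => ?_, ?_, ?_, fun n hn => ?_⟩⟩
  · obtain ⟨T, h, hT⟩ := CycleSpectrum.exists_translationLength hΓ hT hdeg g
    obtain ⟨n, rfl⟩ := hT _ (CycleSpectrum.cycleGraph_parityColoring (by omega) he)
    refine ⟨n, ?_⟩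
    convert h using 1
    push_cast
    ring
  · obtain ⟨T, h, -⟩ := CycleSpectrum.exists_translationLength hΓ hT hdeg g
    exact ⟨T, by rwa [Int.cast_natCast]⟩
  · obtain ⟨m, hm⟩ := ho
    have := CycleSpectrum.oddCycleElement_translationLength (k := k) (by omega) (m := m) (by omega)
      hm
    rwa [Nat.cast_mul, Nat.cast_sub (by omega : 4 ≤ k), Nat.cast_ofNat] at this
  · have : (0 : ℝ) < k - 4 := by linarith
    positivity
  · obtain ⟨m, hm⟩ := ho
    have h1 : (k : ℝ) * ((k : ℝ) - 4) = 2 * n := by linarith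
    have h2 : (k : ℤ) * ((k : ℤ) - 4) = 2 * n := by exact_mod_cast h1
    have h3 : (k : ℤ) = 2 * m + 1 := by exact_mod_cast hm
    rw [h3] at h2
    -- For odd `k` the product `k (k - 4)` is odd, so half of it is not an integer.
    have h4 : (2 * (m : ℤ) + 1) * (2 * m + 1 - 4) = 2 * (2 * m * m - 2 * m - 2) + 1 := by ring
    omega
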